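/- Let $N\ge 1$, let $\Omega\subset\mathbb{R}^N$ be a bounded domain (nonempty, open, connected) with Lipschitz boundary, and let $\tau>0$ and $p>1$. For $f\in L^{p/(p-1)}(\Omega)$ consider the Neumann problem $$-\operatorname{div}\left(|\nabla u|^{p-2}\nabla u\right)+\tau|u|^{p-2}u=f\ \text{ in }\Omega,\qquad \nabla u\cdot\nu=0\ \text{ on }\partial\Omega,$$ where $\nu$ is the unit outward normal. A weak solution is a function $u\in W^{1,p}(\Omega)$ such that $$\int_\Omega|\nabla u|^{p-2}\nabla u\cdot\nabla\xi\,dx+\tau\int_\Omega|u|^{p-2}u\,\xi\,dx=\int_\Omega f\,\xi\,dx\qquad\text{for all }\xi\in W^{1,p}(\Omega).$$ (i) For every $f\in L^{p/(p-1)}(\Omega)$ the problem has exactly one weak solution $u\in W^{1,p}(\Omega)$ (up to equality almost everywhere in $\Omega$). (ii) Let $q\in[1,\infty]$ with $q>N/p$. There is a constant $c>0$, depending only on $\Omega$, $N$, $p$, $\tau$ and $q$, such that for every $f\in L^{p/(p-1)}(\Omega)\cap L^q(\Omega)$ the weak solution $u$ is bounded, i.e. $u\in L^\infty(\Omega)$,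 and $$\|u\|_\infty\le c\,\|u\|_1+c\,\|f\|_q^{\frac1{p-1}},$$ where $\|\cdot\|_r$ denotes the norm of $L^r(\Omega)$. -/

import Mathlib

open MeasureTheory Set
open scoped ENNReal ContDiff

noncomputable section

/-- Euclidean space `ℝ^N`. -/
abbrev RN (N : ℕ) : Type := EuclideanSpace ℝ (Fin N)

/-- `Ω` has a Lipschitz boundary: near each boundary point there are a unit vector `e` and a
Lipschitz function `g` of the component `y - ⟪e, y⟫ e` of `y` orthogonal to `e` such that, in a
ball around that point, `Ω` is the set of points lying strictly above the graph of `g` in the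
direction `e`. -/
def HasLipschitzBoundary {N : ℕ} (Ω : Set (RN N)) : Prop :=
  ∀ x ∈ frontier Ω, ∃ e : RN N, ‖e‖ = 1 ∧ ∃ r : ℝ, 0 < r ∧
    ∃ (K : NNReal) (g : RN N → ℝ), LipschitzWith K g ∧
      ∀ y ∈ Metric.ball x r, y ∈ Ω ↔ g (y - (inner ℝ e y) • e) < inner ℝ e y

/-- `G` is the weak gradient of `u` in the open set `Ω`: both are locally integrable in `Ω` and
`∫_Ω u ∂_v φ = - ∫_Ω φ (G · v)` for all `φ ∈ C_c^∞(Ω)` and all directions `v`. -/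
structure IsWeakGradient {N : ℕ} (Ω : Set (RN N)) (u : RN N → ℝ) (G : RN N → RN N) : Prop where
  locallyIntegrableOn : LocallyIntegrableOn u Ω volume
  locallyIntegrableOn_grad : LocallyIntegrableOn G Ω volume
  integral_eq : ∀ φ : RN N → ℝ, ContDiff ℝ ∞ φ → HasCompactSupport φ → tsupport φ ⊆ Ω →
    ∀ v : RN N, ∫ x in Ω, u x * fderiv ℝ φ x v = - ∫ x in Ω, φ x * inner ℝ (G x) v

/-- `u` belongs to the Sobolev space `W^{1,p}(Ω)` and its weak gradient is `G`. -/
structure IsSobolevWithGradient {N : ℕ} (p : ℝ) (Ω : Set (RN N)) (u : RN N → ℝ)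
    (G : RN N → RN N) : Prop where
  memLp : MemLp u (ENNReal.ofReal p) (volume.restrict Ω)
  memLp_grad : MemLp G (ENNReal.ofReal p) (volume.restrict Ω)
  isWeakGradient : IsWeakGradient Ω u G

/-- `u ∈ W^{1,p}(Ω)` is a weak solution of `-Δ_p u + τ |u|^{p-2} u = f` in `Ω`, with
`∇u · ν = 0` on `∂Ω`: for all `ξ ∈ W^{1,p}(Ω)`,
`∫_Ω |∇u|^{p-2} ∇u · ∇ξ + τ ∫_Ω |u|^{p-2} u ξ = ∫_Ω f ξ`.
The weak gradients `G` of `u` and `H` of `ξ` are determined almost everywhere in `Ω`. -/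
def IsNeumannWeakSolution {N : ℕ} (p τ : ℝ) (Ω : Set (RN N)) (f u : RN N → ℝ) : Prop :=
  ∃ G : RN N → RN N, IsSobolevWithGradient p Ω u G ∧
    ∀ (ξ : RN N → ℝ) (H : RN N → RN N), IsSobolevWithGradient p Ω ξ H →
      (∫ x in Ω, ‖G x‖ ^ (p - 2) * inner ℝ (G x) (H x))
        + τ * (∫ x in Ω, |u x| ^ (p - 2) * u x * ξ x) = ∫ x in Ω, f x * ξ x

end

/-! Existence and uniqueness come from convexity. Weak solutions are the critical points of the
energy `(∫ ‖∇u‖ ^ p + τ ∫ |u| ^ p) / p - ∫ f u` on `W^{1,p}(Ω)`, a closed subspace of `L^p × L^p`.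
The midpoint of two almost-minimizers has energy at least the infimum, so uniform convexity of `L^p`
makes every minimizing sequence Cauchy in norm; no weak compactness is needed
(`exists_forall_energy_le`). Differentiating the energy at the minimizer gives the equation.
Subtracting the equations of two solutions, testing with their difference and using strict
monotonicity of `a ↦ ‖a‖ ^ (p - 2) • a` gives uniqueness.

The bound is a Stampacchia argument. Testing the equation with a truncation of `(u - k)⁺` at height
comparable to `d` controls its `W^{1,p}` norm by `f` on the superlevel set `{u > k}`
(`truncation_energy_le`). A Sobolev-type inequality turns this into a decay relation between the
measures of `{u > k + d}` and `{u > k}` (`exists_superlevel_decay`), and `q > N / p` is what makes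
the exponent on the right the larger one, or for `q = 1` makes iteration superfluous. Hence `{u >
d}` is null once `d ^ (p - 1)` dominates a multiple of `‖f‖_q`. The same holds for `-u`. Since `τ >
0`, the bound is obtained even without the term in `‖u‖_1`.

The Sobolev-type inequality (`exists_setLIntegral_enorm_le`) bounds `∫_M |u|` with a gain of `|M| ^
(θ / p)` over Hölder's exponent, for any `θ ∈ [0, 1]` with `N θ < p`. It is proved directly from the
boundary geometry: a Lipschitz domain has the cone property, and averages of `u` over balls
shrinking to `x` inside a cone with vertex `x` represent `u x` by an integral of the gradient
against a kernel of Riesz type. -/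

open Filter Topology
open scoped NNReal

/-! ### Averages along cones and the pointwise estimate of `u` by its gradient -/

/-- The divergence form of the weak gradient identity. -/
theorem IsWeakGradient.integral_sum {N : ℕ} {Ω : Set (RN N)} {u : RN N → ℝ} {G : RN N → RN N}
    (h : IsWeakGradient Ω u G) (hu : IntegrableOn u Ω) (hG : IntegrableOn G Ω)
    (χ : Fin N → RN N → ℝ) (hχ : ∀ i, ContDiff ℝ ∞ (χ i)) (hc : ∀ i, HasCompactSupport (χ i))
    (hs : ∀ i, tsupport (χ i) ⊆ Ω) (e : Fin N → RN N) :
    ∫ x in Ω, u x * ∑ i, fderiv ℝ (χ i) x (e i)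
      = - ∫ x in Ω, inner ℝ (G x) (∑ i, χ i x • e i) := by
  have h1 : ∀ i, Integrable (fun x => u x * fderiv ℝ (χ i) x (e i)) (volume.restrict Ω) := by
    intro i
    have hcont : Continuous (fun x => fderiv ℝ (χ i) x (e i)) :=
      ((hχ i).continuous_fderiv (by simp)).clm_apply continuous_const
    have hcs : HasCompactSupport (fun x => fderiv ℝ (χ i) x (e i)) := (hc i).fderiv_apply ℝ (e i)
    obtain ⟨C, hC⟩ := hcont.bounded_above_of_compact_support hcs
    exact hu.mul_bdd hcont.aestronglyMeasurable (Eventually.of_forall hC)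
  have h2 : ∀ i, Integrable (fun x => χ i x * inner ℝ (G x) (e i)) (volume.restrict Ω) := by
    intro i
    obtain ⟨C, hC⟩ := (hχ i).continuous.bounded_above_of_compact_support (hc i)
    exact (hG.inner_const (e i)).bdd_mul (hχ i).continuous.aestronglyMeasurable
      (Eventually.of_forall hC)
  have e1 : ∀ x, inner ℝ (G x) (∑ i, χ i x • e i) = ∑ i, χ i x * inner ℝ (G x) (e i) := by
    intro x
    simp [inner_sum, inner_smul_right]
  simp_rw [e1, Finset.mul_sum]
  rw [integral_finsetSum _ fun i _ => h1 i, integral_finsetSum _ fun i _ => h2 i,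
    ← Finset.sum_neg_distrib]
  exact Finset.sum_congr rfl fun i _ => h.integral_eq (χ i) (hχ i) (hc i) (hs i) (e i)

/-- At `y = s⁻¹ • v` the bracket is the divergence of the field `y ↦ ψ y • y` (see
`sum_fderiv_coord_mul`). Thus differentiating the kernel in its scale yields a divergence in space,
which a weak gradient can absorb. -/
theorem hasDerivAt_dilation {N : ℕ} {ψ : RN N → ℝ} (hψ : Differentiable ℝ ψ) (v : RN N) {s : ℝ}
    (hs : s ≠ 0) :
    HasDerivAt (fun s : ℝ => (s ^ N)⁻¹ * ψ (s⁻¹ • v))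
      (-((s ^ (N + 1))⁻¹ * (N * ψ (s⁻¹ • v) + fderiv ℝ ψ (s⁻¹ • v) (s⁻¹ • v)))) s := by
  have h1 : HasDerivAt (fun s : ℝ => s⁻¹ • v) ((-(s ^ 2)⁻¹) • v) s := (hasDerivAt_inv hs).smul_const v
  have h2 := ((hψ (s⁻¹ • v)).hasFDerivAt).comp_hasDerivAt s h1
  have h3 : HasDerivAt (fun s : ℝ => (s ^ N)⁻¹) (-(N * s ^ (N - 1)) / (s ^ N) ^ 2) s :=
    (hasDerivAt_pow N s).fun_inv (pow_ne_zero _ hs)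
  refine (h3.mul h2).congr_deriv ?_
  simp only [map_smul, smul_eq_mul, Function.comp]
  rcases N with _ | N
  · simp; field_simp
  · simp only [Nat.add_sub_cancel]
    field_simp
    ring

theorem sum_fderiv_coord_mul {N : ℕ} {ψ : RN N → ℝ} (hψ : Differentiable ℝ ψ) (y : RN N) :
    ∑ i, fderiv ℝ (fun y : RN N => y i * ψ y) y (EuclideanSpace.single i 1)
      = N * ψ y + fderiv ℝ ψ y y := by
  have h1 : ∀ i : Fin N, fderiv ℝ (fun y : RN N => y i * ψ y) y (EuclideanSpace.single i 1)
      = y i * fderiv ℝ ψ y (EuclideanSpace.single i 1) + ψ y := by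
    intro i
    have := (EuclideanSpace.proj (𝕜 := ℝ) i : RN N →L[ℝ] ℝ).hasFDerivAt (x := y)
    have h2 := this.mul (hψ y).hasFDerivAt
    have h3 : HasFDerivAt (fun y : RN N => y i * ψ y) _ y := h2
    rw [h3.fderiv]
    simp
  have h4 : y = ∑ i, y i • EuclideanSpace.single i (1 : ℝ) := by
    ext j
    simp [Finset.sum_apply, Pi.single_apply]
  simp_rw [h1, Finset.sum_add_distrib]
  conv_rhs => rw [add_comm]; arg 1; arg 2; rw [h4]
  simp [map_sum]

/-- As `s` runs through `(0, 1]` these balls sweep out a truncated cone with vertex `x` and axis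
`b`; this is how the cone condition makes the dilated kernels admissible test functions. -/
theorem tsupport_dilation_subset {N : ℕ} {χ : RN N → ℝ} {b x : RN N} {δ s : ℝ}
    (hχ : tsupport χ ⊆ Metric.closedBall b δ) (hs : 0 < s) :
    tsupport (fun z => (s ^ N)⁻¹ * χ (s⁻¹ • (z - x))) ⊆ Metric.closedBall (x + s • b) (s * δ) := by
  refine closure_minimal ?_ Metric.isClosed_closedBall
  intro z hz
  have h1 : χ (s⁻¹ • (z - x)) ≠ 0 := fun h => hz (by simp [h])
  have h2 : s⁻¹ • (z - x) ∈ Metric.closedBall b δ := hχ (subset_tsupport _ h1)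
  rw [mem_closedBall_iff_norm] at h2 ⊢
  have h3 : z - (x + s • b) = s • (s⁻¹ • (z - x) - b) := by
    rw [smul_sub, smul_inv_smul₀ hs.ne']; abel
  rw [h3, norm_smul, Real.norm_of_nonneg hs.le]
  gcongr

theorem fderiv_dilation {N : ℕ} {χ : RN N → ℝ} (hχ : Differentiable ℝ χ) (x z v : RN N) (s : ℝ) :
    fderiv ℝ (fun z => (s ^ N)⁻¹ * χ (s⁻¹ • (z - x))) z v
      = (s ^ (N + 1))⁻¹ * fderiv ℝ χ (s⁻¹ • (z - x)) v := by
  have h1 : HasFDerivAt (fun z : RN N => s⁻¹ • (z - x)) (s⁻¹ • ContinuousLinearMap.id ℝ (RN N)) z :=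
    ((hasFDerivAt_id z).sub_const x).const_smul s⁻¹
  have h2 : HasFDerivAt (fun z => χ (s⁻¹ • (z - x))) _ z :=
    (hχ (s⁻¹ • (z - x))).hasFDerivAt.comp z h1
  rw [(h2.const_mul (s ^ N)⁻¹).fderiv]
  simp only [ContinuousLinearMap.comp_smul, ContinuousLinearMap.comp_id,
    _root_.smul_apply, smul_eq_mul]
  rw [pow_succ, mul_inv, mul_assoc]

theorem IsWeakGradient.integral_sum_dilation {N : ℕ} {Ω : Set (RN N)} {u : RN N → ℝ}
    {G : RN N → RN N} (h : IsWeakGradient Ω u G) (hu : IntegrableOn u Ω) (hG : IntegrableOn G Ω)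
    {χ : Fin N → RN N → ℝ} (hχ : ∀ i, ContDiff ℝ ∞ (χ i)) {b x : RN N} {δ s : ℝ}
    (hsupp : ∀ i, tsupport (χ i) ⊆ Metric.closedBall b δ) (hs : 0 < s)
    (hΩ : Metric.closedBall (x + s • b) (s * δ) ⊆ Ω) (e : Fin N → RN N) :
    ∫ z in Ω, u z * ((s ^ (N + 1))⁻¹ * ∑ i, fderiv ℝ (χ i) (s⁻¹ • (z - x)) (e i))
      = -∫ z in Ω, inner ℝ (G z) (∑ i, ((s ^ N)⁻¹ * χ i (s⁻¹ • (z - x))) • e i) := by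
  have hts : ∀ i, tsupport (fun z => (s ^ N)⁻¹ * χ i (s⁻¹ • (z - x)))
      ⊆ Metric.closedBall (x + s • b) (s * δ) := fun i => tsupport_dilation_subset (hsupp i) hs
  have hd : ∀ i, ContDiff ℝ ∞ (fun z => (s ^ N)⁻¹ * χ i (s⁻¹ • (z - x))) := fun i =>
    contDiff_const.mul ((hχ i).comp (by fun_prop))
  have hc : ∀ i, HasCompactSupport (fun z => (s ^ N)⁻¹ * χ i (s⁻¹ • (z - x))) := fun i =>
    HasCompactSupport.of_support_subset_isCompact (isCompact_closedBall _ _)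
      ((subset_tsupport _).trans (hts i))
  rw [← h.integral_sum hu hG _ hd hc (fun i => (hts i).trans hΩ) e]
  simp_rw [fderiv_dilation ((hχ _).differentiable (by simp)), Finset.mul_sum]

theorem IsWeakGradient.integral_dilation {N : ℕ} {Ω : Set (RN N)} {u : RN N → ℝ} {G : RN N → RN N}
    (h : IsWeakGradient Ω u G) (hu : IntegrableOn u Ω) (hG : IntegrableOn G Ω)
    {ψ : RN N → ℝ} (hψ : ContDiff ℝ ∞ ψ) {b x : RN N} {δ s : ℝ}
    (hsupp : tsupport ψ ⊆ Metric.closedBall b δ) (hs : 0 < s)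
    (hΩ : Metric.closedBall (x + s • b) (s * δ) ⊆ Ω) :
    ∫ z in Ω, u z * -((s ^ (N + 1))⁻¹ * (N * ψ (s⁻¹ • (z - x))
        + fderiv ℝ ψ (s⁻¹ • (z - x)) (s⁻¹ • (z - x))))
      = ∫ z in Ω, inner ℝ (G z) (((s ^ N)⁻¹ * ψ (s⁻¹ • (z - x))) • (s⁻¹ • (z - x))) := by
  have hcd : ∀ i : Fin N, ContDiff ℝ ∞ (fun y : RN N => y i * ψ y) := fun i =>
    ((EuclideanSpace.proj (𝕜 := ℝ) i : RN N →L[ℝ] ℝ).contDiff).mul hψ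
  have hts : ∀ i : Fin N, tsupport (fun y : RN N => y i * ψ y) ⊆ Metric.closedBall b δ := fun i =>
    (closure_mono (Function.support_mul_subset_right _ _)).trans hsupp
  have key := h.integral_sum_dilation hu hG hcd hts hs hΩ (fun i => EuclideanSpace.single i 1)
  have e2 : ∀ y : RN N, ∑ i, ((s ^ N)⁻¹ * (y i * ψ y)) • EuclideanSpace.single i (1 : ℝ)
      = ((s ^ N)⁻¹ * ψ y) • y := by
    intro y
    ext j
    simp [Finset.sum_apply, Pi.single_apply]
    ring
  simp only [sum_fderiv_coord_mul (hψ.differentiable (by simp)), e2] at key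
  simp_rw [mul_neg, integral_neg]
  rw [key, neg_neg]

theorem IsWeakGradient.hasDerivAt_average {N : ℕ} {Ω : Set (RN N)} {u : RN N → ℝ}
    {G : RN N → RN N} (h : IsWeakGradient Ω u G) (hu : IntegrableOn u Ω) (hG : IntegrableOn G Ω)
    {ψ : RN N → ℝ} (hψ : ContDiff ℝ ∞ ψ) {b x : RN N} {δ : ℝ}
    (hsupp : tsupport ψ ⊆ Metric.closedBall b δ) 
    (hΩ : ∀ s ∈ Ioc (0 : ℝ) 1, Metric.closedBall (x + s • b) (s * δ) ⊆ Ω) :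
    (∀ s ∈ Ioc (0 : ℝ) 1, HasDerivAt (fun s => ∫ z in Ω, u z * ((s ^ N)⁻¹ * ψ (s⁻¹ • (z - x))))
      (∫ z in Ω, inner ℝ (G z) (((s ^ N)⁻¹ * ψ (s⁻¹ • (z - x))) • (s⁻¹ • (z - x)))) s) ∧
    ContinuousOn (fun s => 
      ∫ z in Ω, inner ℝ (G z) (((s ^ N)⁻¹ * ψ (s⁻¹ • (z - x))) • (s⁻¹ • (z - x)))) (Ioc 0 1) := by
  have hψc : HasCompactSupport ψ := HasCompactSupport.of_support_subset_isCompact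
    (isCompact_closedBall _ _) ((subset_tsupport _).trans hsupp)
  set κ : RN N → ℝ := fun y => N * ψ y + fderiv ℝ ψ y y with hκ
  have hκc : Continuous κ := (continuous_const.mul hψ.continuous).add
    ((hψ.continuous_fderiv (by simp)).clm_apply continuous_id)
  have hκs : HasCompactSupport κ := by
    refine HasCompactSupport.add (hψc.mul_left) ?_
    refine (hψc.fderiv ℝ).mono ?_
    intro y hy hy'
    exact hy (by simp [hy'])
  obtain ⟨C, hC⟩ := hκc.bounded_above_of_compact_support hκs
  obtain ⟨C', hC'⟩ := hψ.continuous.bounded_above_of_compact_support hψc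
  have hC0 : 0 ≤ C := (norm_nonneg _).trans (hC 0)
  have harg : ∀ s : ℝ, Continuous (fun z : RN N => s⁻¹ • (z - x)) := fun s => by fun_prop
  have hF'm : ∀ s : ℝ, AEStronglyMeasurable
      (fun z => u z * -((s ^ (N + 1))⁻¹ * κ (s⁻¹ • (z - x)))) (volume.restrict Ω) := fun s =>
    hu.aestronglyMeasurable.mul
      (continuous_const.mul (hκc.comp (harg s))).neg.aestronglyMeasurable
  have hbd : ∀ s₀ > (0 : ℝ), ∀ s ≥ s₀, ∀ z, ‖u z * -((s ^ (N + 1))⁻¹ * κ (s⁻¹ • (z - x)))‖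
      ≤ ‖u z‖ * ((s₀ ^ (N + 1))⁻¹ * C) := by
    intro s₀ hs₀ s hs z
    have : 0 < s := hs₀.trans_le hs
    rw [norm_mul, norm_neg, norm_mul, norm_inv, norm_pow, Real.norm_of_nonneg this.le]
    gcongr
    exact hC _
  have hbi : ∀ c : ℝ, Integrable (fun z => ‖u z‖ * c) (volume.restrict Ω) := fun c =>
    hu.norm.mul_const c
  constructor
  · intro s hs
    -- In terms of `u` the claim is plain differentiation under the integral; staying at scales at
    -- least `s / 2` keeps the kernels uniformly bounded.
    rw [← h.integral_dilation hu hG hψ hsupp hs.1 (hΩ s hs)]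
    refine (hasDerivAt_integral_of_dominated_loc_of_deriv_le (s := Ici (s / 2))
      (bound := fun z => ‖u z‖ * (((s / 2) ^ (N + 1))⁻¹ * C))
      (F' := fun s z => u z * -((s ^ (N + 1))⁻¹ * κ (s⁻¹ • (z - x))))
      (Ici_mem_nhds (by linarith [hs.1])) (Eventually.of_forall fun t => ?_) ?_ (hF'm s)
      (Eventually.of_forall fun z t ht => hbd _ (by linarith [hs.1]) t ht z) (hbi _)
      (Eventually.of_forall fun z t ht => ?_)).2
    · exact hu.aestronglyMeasurable.mul
        (continuous_const.mul (hψ.continuous.comp (harg t))).aestronglyMeasurable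
    · refine hu.mul_bdd (c := ‖(s ^ N)⁻¹‖ * C')
        (continuous_const.mul (hψ.continuous.comp (harg s))).aestronglyMeasurable
        (Eventually.of_forall fun z => ?_)
      rw [norm_mul]
      gcongr
      exact hC' _
    · have ht' : t ≠ 0 := by
        have : s / 2 ≤ t := ht
        have := hs.1
        intro h0; linarith
      exact (hasDerivAt_dilation (hψ.differentiable (by simp)) (z - x) ht').const_mul (u z)
  · refine ContinuousOn.congr (f := fun s => ∫ z in Ω, u z * -((s ^ (N + 1))⁻¹ * κ (s⁻¹ • (z - x))))
      ?_ fun s hs => (h.integral_dilation hu hG hψ hsupp hs.1 (hΩ s hs)).symm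
    intro s hs
    refine ContinuousAt.continuousWithinAt ?_
    refine continuousAt_of_dominated (bound := fun z => ‖u z‖ * (((s / 2) ^ (N + 1))⁻¹ * C))
      (Eventually.of_forall fun t => hF'm t) ?_ (hbi _) ?_
    · filter_upwards [Ici_mem_nhds (show s / 2 < s by linarith [hs.1])] with t ht
      exact Eventually.of_forall fun z => hbd _ (by linarith [hs.1]) t ht z
    · refine Eventually.of_forall fun z => ?_
      have hs0 := hs.1.ne'
      have hp := pow_ne_zero (N + 1) hs0
      have h1 : ContinuousAt (fun s : ℝ => κ (s⁻¹ • (z - x))) s :=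
        hκc.continuousAt.comp ((continuousAt_inv₀ hs0).smul continuousAt_const)
      exact continuousAt_const.mul (((continuousAt_id.pow _).inv₀ hp).mul h1).neg

/-- The points of `Ω` at which a truncated cone of a given shape, with its vertex at the point,
is contained in `Ω`. -/
def conePoints {N : ℕ} (Ω : Set (RN N)) (b : RN N) (δ : ℝ) : Set (RN N) :=
  {x ∈ Ω | ∀ s ∈ Ioc (0 : ℝ) 1, Metric.closedBall (x + s • b) (s * δ) ⊆ Ω}

/-- On the support of `ψ` the argument `s⁻¹ • (z - x)` has norm at most `‖b‖ + δ`, which bounds both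
the vector factor and the distance from `z` to `x`. -/
theorem enorm_dilation_smul_le {N : ℕ} {ψ : RN N → ℝ} {b x z g : RN N} {δ C s : ℝ}
    (hsupp : tsupport ψ ⊆ Metric.closedBall b δ) (hC : ∀ y, ‖ψ y‖ ≤ C) (hs : 0 < s) :
    ‖inner ℝ g (((s ^ N)⁻¹ * ψ (s⁻¹ • (z - x))) • (s⁻¹ • (z - x)))‖ₑ
      ≤ ‖g‖ₑ * (ENNReal.ofReal (C * (‖b‖ + δ) * (s ^ N)⁻¹)
        * (Metric.closedBall x ((‖b‖ + δ) * s)).indicator 1 z) := by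
  by_cases h0 : ψ (s⁻¹ • (z - x)) = 0
  · simp [h0]
  have hb : ‖s⁻¹ • (z - x)‖ ≤ ‖b‖ + δ := by
    have h1 := hsupp (subset_tsupport _ h0)
    rw [mem_closedBall_iff_norm] at h1
    linarith [norm_le_norm_add_norm_sub b (s⁻¹ • (z - x)), norm_sub_rev b (s⁻¹ • (z - x))]
  have hz : z ∈ Metric.closedBall x ((‖b‖ + δ) * s) := by
    rw [mem_closedBall_iff_norm]
    rw [norm_smul, Real.norm_of_nonneg (inv_pos.2 hs).le, inv_mul_le_iff₀ hs] at hb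
    linarith
  have hC0 : 0 ≤ C := (norm_nonneg _).trans (hC 0)
  rw [indicator_of_mem hz, Pi.one_apply, mul_one, ← ofReal_norm, ← ofReal_norm, 
    ← ENNReal.ofReal_mul (norm_nonneg _)]
  refine ENNReal.ofReal_le_ofReal ((norm_inner_le_norm _ _).trans ?_)
  gcongr
  rw [norm_smul, norm_mul, Real.norm_of_nonneg (by positivity : 0 ≤ (s ^ N)⁻¹)]
  calc (s ^ N)⁻¹ * ‖ψ (s⁻¹ • (z - x))‖ * ‖s⁻¹ • (z - x)‖ ≤ (s ^ N)⁻¹ * C * (‖b‖ + δ) := by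
        gcongr; exact hC _
    _ = _ := by ring

/-- The fundamental theorem of calculus in the scale, between `s` and `1`. The right side does not
depend on `s`, so it survives the limit `s → 0`. -/
theorem IsWeakGradient.enorm_average_le {N : ℕ} {Ω : Set (RN N)} {u : RN N → ℝ}
    {G : RN N → RN N} (h : IsWeakGradient Ω u G) (hu : IntegrableOn u Ω) (hG : IntegrableOn G Ω)
    {ψ : RN N → ℝ} (hψ : ContDiff ℝ ∞ ψ) {b x : RN N} {δ C : ℝ}
    (hsupp : tsupport ψ ⊆ Metric.closedBall b δ) (hC : ∀ y, ‖ψ y‖ ≤ C) 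
    (hx : x ∈ conePoints Ω b δ) {s : ℝ} (hs : s ∈ Ioc (0 : ℝ) 1) :
    ‖∫ z in Ω, u z * ((s ^ N)⁻¹ * ψ (s⁻¹ • (z - x)))‖ₑ ≤
      ENNReal.ofReal C * (∫⁻ z in Ω, ‖u z‖ₑ)
      + ∫⁻ t in Ioc (0 : ℝ) 1, ∫⁻ z in Ω, ‖G z‖ₑ * (ENNReal.ofReal (C * (‖b‖ + δ) * (t ^ N)⁻¹)
        * (Metric.closedBall x ((‖b‖ + δ) * t)).indicator 1 z) := by
  obtain ⟨hd, hcont⟩ := h.hasDerivAt_average hu hG hψ hsupp hx.2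
  set a : ℝ → ℝ := fun s => ∫ z in Ω, u z * ((s ^ N)⁻¹ * ψ (s⁻¹ • (z - x)))
  set a' : ℝ → ℝ := fun s => 
    ∫ z in Ω, inner ℝ (G z) (((s ^ N)⁻¹ * ψ (s⁻¹ • (z - x))) • (s⁻¹ • (z - x)))
  have hsub : uIcc s 1 ⊆ Ioc 0 1 := by
    rw [uIcc_of_le hs.2]; exact fun t ht => ⟨hs.1.trans_le ht.1, ht.2⟩
  have hftc : ∫ t in s..1, a' t = a 1 - a s :=
    intervalIntegral.integral_eq_sub_of_hasDerivAt (fun t ht => hd t (hsub ht))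
      (hcont.mono hsub).intervalIntegrable
  have h1 : ‖a 1‖ₑ ≤ ENNReal.ofReal C * ∫⁻ z in Ω, ‖u z‖ₑ := by
    rw [← lintegral_const_mul' _ _ ENNReal.ofReal_ne_top]
    refine (enorm_integral_le_lintegral_enorm _).trans (lintegral_mono fun z => ?_)
    simp only [one_pow, inv_one, one_mul, one_smul, enorm_mul]
    rw [mul_comm]
    gcongr
    rw [← ofReal_norm]
    exact ENNReal.ofReal_le_ofReal (hC _)
  have h2 : ‖∫ t in s..1, a' t‖ₑ ≤ ∫⁻ t in Ioc (0 : ℝ) 1, ∫⁻ z in Ω, ‖G z‖ₑ *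
      (ENNReal.ofReal (C * (‖b‖ + δ) * (t ^ N)⁻¹)
        * (Metric.closedBall x ((‖b‖ + δ) * t)).indicator 1 z) := by
    rw [intervalIntegral.integral_of_le hs.2]
    refine (enorm_integral_le_lintegral_enorm _).trans ?_
    refine (lintegral_mono_set (Ioc_subset_Ioc_left hs.1.le)).trans ?_
    refine setLIntegral_mono' measurableSet_Ioc fun t ht => ?_
    refine (enorm_integral_le_lintegral_enorm _).trans (lintegral_mono fun z => ?_)
    exact enorm_dilation_smul_le hsupp hC ht.1
  have h3 : a s = a 1 - ∫ t in s..1, a' t := by rw [hftc]; ring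
  change ‖a s‖ₑ ≤ _
  rw [h3]
  exact (enorm_sub_le).trans (add_le_add h1 h2)

theorem integral_dilation_eq {N : ℕ} (ψ : RN N → ℝ) (x : RN N) {s : ℝ} (hs : 0 < s) :
    ∫ z, (s ^ N)⁻¹ * ψ (s⁻¹ • (z - x)) = ∫ z, ψ z := by
  rw [integral_const_mul, integral_sub_right_eq_self (fun z => ψ (s⁻¹ • z)) x,
    Measure.integral_comp_inv_smul]
  simp [abs_of_pos (pow_pos hs N), hs.ne']

theorem ae_tendsto_dilation {N : ℕ} {u : RN N → ℝ} (hu : Integrable u) {ψ : RN N → ℝ}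
    (hψ : Continuous ψ) (hψ1 : ∫ z, ψ z = 1) {b : RN N} {δ C : ℝ} (hδ : 0 < δ)
    (hsupp : tsupport ψ ⊆ Metric.closedBall b δ) (hC : ∀ y, ‖ψ y‖ ≤ C) :
    ∀ᵐ x, Tendsto (fun s : ℝ => ∫ z, u z * ((s ^ N)⁻¹ * ψ (s⁻¹ • (z - x)))) (𝓝[>] 0)
      (𝓝 (u x)) := by
  have hC0 : 0 ≤ C := (norm_nonneg _).trans (hC 0)
  -- The averaging balls have centre `x + s • b` and radius `s * δ`, so they are not centred at `x`.
  -- The Lebesgue differentiation theorem still applies because `x` lies in their enlargement by the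
  -- fixed factor `‖b‖ / δ`.
  filter_upwards [IsUnifLocDoublingMeasure.ae_tendsto_average_norm_sub (μ := volume)
    hu.locallyIntegrable (‖b‖ / δ)] with x hx
  have hlim := hx (l := 𝓝[>] (0 : ℝ)) (fun s => x + s • b) (fun s => s * δ) (by
      refine tendsto_nhdsWithin_iff.2 ⟨?_, ?_⟩
      · have : Tendsto (fun s : ℝ => s * δ) (𝓝 0) (𝓝 (0 * δ)) := tendsto_id.mul_const δ
        rw [zero_mul] at this
        exact this.mono_left nhdsWithin_le_nhds
      · filter_upwards [self_mem_nhdsWithin] with s hs using mul_pos hs hδ) (by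
      filter_upwards [self_mem_nhdsWithin] with s hs
      rw [mem_closedBall_iff_norm, sub_add_cancel_left, norm_neg, norm_smul, 
        Real.norm_of_nonneg (le_of_lt hs)]
      exact le_of_eq (by field_simp))
  rw [tendsto_iff_norm_sub_tendsto_zero]
  set V : ℝ := volume.real (Metric.closedBall (0 : RN N) δ)
  have hlim2 := hlim.const_mul (V * C)
  rw [mul_zero] at hlim2
  refine squeeze_zero' (Eventually.of_forall fun s => norm_nonneg _) ?_ hlim2
  filter_upwards [self_mem_nhdsWithin] with s hs
  have hs : 0 < s := hs
  have hcd : Continuous (fun z => (s ^ N)⁻¹ * ψ (s⁻¹ • (z - x))) := by fun_prop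
  have hcs : HasCompactSupport (fun z => (s ^ N)⁻¹ * ψ (s⁻¹ • (z - x))) :=
    HasCompactSupport.of_support_subset_isCompact (isCompact_closedBall _ _)
      ((subset_tsupport _).trans (tsupport_dilation_subset hsupp hs))
  have hid : Integrable (fun z => (s ^ N)⁻¹ * ψ (s⁻¹ • (z - x))) := 
    hcd.integrable_of_hasCompactSupport hcs
  have hiu : Integrable (fun z => u z * ((s ^ N)⁻¹ * ψ (s⁻¹ • (z - x)))) := by
    refine hu.mul_bdd (c := ‖(s ^ N)⁻¹‖ * C) hcd.aestronglyMeasurable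
      (Eventually.of_forall fun z => ?_)
    rw [norm_mul]; gcongr; exact hC _
  have e1 : (∫ z, u z * ((s ^ N)⁻¹ * ψ (s⁻¹ • (z - x)))) - u x
      = ∫ z, (u z - u x) * ((s ^ N)⁻¹ * ψ (s⁻¹ • (z - x))) := by
    simp_rw [sub_mul]
    rw [integral_sub hiu (hid.const_mul _), integral_const_mul, integral_dilation_eq ψ x hs, hψ1,
      mul_one]
  have hball : volume.real (Metric.closedBall (x + s • b) (s * δ)) = s ^ N * V := by
    simp only [V, Measure.real]
    rw [Measure.addHaar_closedBall' _ _ (by positivity), Measure.addHaar_closedBall' _ _ hδ.le]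
    simp [mul_pow, ENNReal.toReal_mul, ENNReal.toReal_ofReal, hs.le, hδ.le, pow_nonneg, mul_assoc]
  rw [e1, ← setIntegral_eq_integral_of_forall_compl_eq_zero
    (s := Metric.closedBall (x + s • b) (s * δ))]
  · rw [setAverage_eq, hball]
    have hV : 0 < V := by
      simp only [V, Measure.real]
      exact ENNReal.toReal_pos (Metric.measure_closedBall_pos _ _ hδ).ne' 
        measure_closedBall_lt_top.ne
    have hui : IntegrableOn (fun z => ‖u z - u x‖) (Metric.closedBall (x + s • b) (s * δ)) :=
      (hu.integrableOn.sub (integrableOn_const (measure_closedBall_lt_top.ne))).norm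
    calc _ ≤ ∫ z in Metric.closedBall (x + s • b) (s * δ), 
            ‖(u z - u x) * ((s ^ N)⁻¹ * ψ (s⁻¹ • (z - x)))‖ := norm_integral_le_integral_norm _
      _ ≤ ∫ z in Metric.closedBall (x + s • b) (s * δ), ((s ^ N)⁻¹ * C) * ‖u z - u x‖ := by
          refine integral_mono_of_nonneg (Eventually.of_forall fun z => norm_nonneg _)
            (hui.const_mul _) (Eventually.of_forall fun z => ?_)
          simp only
          rw [norm_mul, norm_mul, norm_inv, norm_pow, Real.norm_of_nonneg hs.le, mul_comm]
          gcongr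
          exact hC _
      _ = _ := by
          rw [integral_const_mul, smul_eq_mul]
          field_simp
  · intro z hz
    have : (s ^ N)⁻¹ * ψ (s⁻¹ • (z - x)) = 0 := by
      by_contra h0
      exact hz (tsupport_dilation_subset hsupp hs (subset_tsupport _ h0))
    rw [this, mul_zero]

theorem exists_ae_enorm_le_of_conePoints {N : ℕ} (b : RN N) {δ : ℝ} (hδ : 0 < δ) :
    ∃ C : ℝ≥0, ∀ {Ω : Set (RN N)} {u : RN N → ℝ} {G : RN N → RN N}, MeasurableSet Ω →
      IsWeakGradient Ω u G → IntegrableOn u Ω → IntegrableOn G Ω →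
      ∀ᵐ x, x ∈ conePoints Ω b δ → ‖u x‖ₑ ≤ C * (∫⁻ z in Ω, ‖u z‖ₑ) +
        ∫⁻ t in Ioc (0 : ℝ) 1, ∫⁻ z in Ω, ‖G z‖ₑ * (C * (ENNReal.ofReal t ^ N)⁻¹ *
          (Metric.closedBall x ((‖b‖ + δ) * t)).indicator 1 z) := by
  let φ : ContDiffBump b := ⟨δ / 2, δ, by positivity, by linarith⟩
  have hφ : ContDiff ℝ ∞ (φ.normed volume) := φ.contDiff_normed (n := ⊤)
  obtain ⟨C, hC⟩ := hφ.continuous.bounded_above_of_compact_support φ.hasCompactSupport_normed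
  have hC0 : 0 ≤ C := (norm_nonneg _).trans (hC 0)
  have hsupp : tsupport (φ.normed volume) ⊆ Metric.closedBall b δ := φ.tsupport_normed_eq.subset
  have hR : 0 < ‖b‖ + δ := by positivity
  -- One constant for both terms of `enorm_average_le`, whose constants are `C` and `C * (‖b‖ + δ)`.
  refine ⟨(C * max 1 (‖b‖ + δ)).toNNReal, fun {Ω u G} hΩ h hu hG => ?_⟩
  filter_upwards [ae_tendsto_dilation ((integrable_indicator_iff hΩ).2 hu) hφ.continuous
    φ.integral_normed hδ hsupp hC] with x hx hxc
  have h1 : ∀ s : ℝ, ∫ z, Ω.indicator u z * ((s ^ N)⁻¹ * φ.normed volume (s⁻¹ • (z - x)))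
      = ∫ z in Ω, u z * ((s ^ N)⁻¹ * φ.normed volume (s⁻¹ • (z - x))) := by
    intro s
    rw [← integral_indicator hΩ]
    congr 1; ext z
    by_cases hz : z ∈ Ω <;> simp [hz]
  rw [indicator_of_mem hxc.1] at hx
  simp_rw [h1] at hx
  refine le_of_tendsto hx.enorm ?_
  filter_upwards [Ioc_mem_nhdsGT (zero_lt_one' ℝ)] with s hs
  refine (h.enorm_average_le hu hG hφ hsupp hC hxc hs).trans ?_
  refine add_le_add ?_ ?_
  · gcongr
    exact ENNReal.ofReal_le_ofReal (le_mul_of_one_le_right hC0 (le_max_left _ _))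
  · refine setLIntegral_mono' measurableSet_Ioc fun t ht => lintegral_mono fun z => ?_
    gcongr
    rw [ENNReal.ofReal_mul (by positivity), ENNReal.ofReal_inv_of_pos (pow_pos ht.1 N), 
      ENNReal.ofReal_pow ht.1.le]
    gcongr
    exact ENNReal.ofReal_le_ofReal (mul_le_mul_of_nonneg_left (le_max_right _ _) hC0)

/-! ### The Sobolev-type inequality on the vertices of a fixed cone -/

theorem volume_closedBall_mul {N : ℕ} (x : RN N) {R t : ℝ} (hR : 0 ≤ R) (ht : 0 ≤ t) :
    volume (Metric.closedBall x (R * t))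
      = volume (Metric.closedBall (0 : RN N) R) * ENNReal.ofReal t ^ N := by
  rw [mul_comm R t, Measure.addHaar_closedBall_mul _ _ ht hR,
    ENNReal.ofReal_pow ht, mul_comm, finrank_euclideanSpace_fin]

theorem measurable_indicator_closedBall {N : ℕ} (r : ℝ) :
    Measurable (fun w : RN N × RN N => (Metric.closedBall w.1 r).indicator (1 : RN N → ℝ≥0∞) w.2) := by
  have : (fun w : RN N × RN N => (Metric.closedBall w.1 r).indicator (1 : RN N → ℝ≥0∞) w.2)
      = {w : RN N × RN N | dist w.2 w.1 ≤ r}.indicator 1 := by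
    ext w
    simp [indicator]
  rw [this]
  exact measurable_one.indicator
    (isClosed_le (continuous_snd.dist continuous_fst) continuous_const).measurableSet

/-- Hölder on `M × Ω` after splitting the indicator as `I = I * I`. In the factor containing `g`,
integrating out `x` first leaves the measure of a ball intersected with `M`, hence the minimum; the
other factor is at most `|M| v`. -/
theorem lintegral_lintegral_closedBall_le {N : ℕ} {p q : ℝ} (hpq : p.HolderConjugate q) 
    {Ω M : Set (RN N)} {g : RN N → ℝ≥0∞} (hg : Measurable g) {r : ℝ} {v : ℝ≥0∞} 
    (hv : ∀ x : RN N, volume (Metric.closedBall x r) ≤ v) :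
    ∫⁻ x in M, ∫⁻ z in Ω, g z * (Metric.closedBall x r).indicator 1 z
      ≤ (∫⁻ z in Ω, g z ^ p) ^ (1 / p) * (min (volume M) v) ^ (1 / p) * (volume M * v) ^ (1 / q) := by
  have hp := hpq.pos
  have hq := hpq.symm.pos
  set I : RN N × RN N → ℝ≥0∞ := fun w => (Metric.closedBall w.1 r).indicator 1 w.2 with hI
  have hIm : Measurable I := measurable_indicator_closedBall r
  have hII : ∀ w, I w * I w = I w := by
    intro w
    by_cases h : w.2 ∈ Metric.closedBall w.1 r <;> simp [I, h]
  have hIp : ∀ (a : ℝ) w, 0 < a → I w ^ a = I w := by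
    intro a w ha
    by_cases h : w.2 ∈ Metric.closedBall w.1 r <;> simp [I, h, ha]
  have hm1 : Measurable (fun w : RN N × RN N => g w.2 * I w) := (hg.comp measurable_snd).mul hIm
  have hm2 : Measurable (fun w : RN N × RN N => g w.2 ^ p * I w) :=
    ((hg.comp measurable_snd).pow_const p).mul hIm
  set ν := (volume.restrict M).prod (volume.restrict Ω)
  have e1 : ∫⁻ x in M, ∫⁻ z in Ω, g z * (Metric.closedBall x r).indicator 1 z
      = ∫⁻ w, ((fun w : RN N × RN N => g w.2 * I w) * I) w ∂ν := by
    rw [lintegral_prod _ (hm1.mul hIm).aemeasurable]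
    simp only [Pi.mul_apply, mul_assoc, hII]
    rfl
  rw [e1]
  refine (ENNReal.lintegral_mul_le_Lp_mul_Lq ν hpq
    hm1.aemeasurable hIm.aemeasurable).trans ?_
  have hsw : ∀ z x : RN N, I (x, z) = (Metric.closedBall z r).indicator 1 x := by
    intro z x
    simp [I, indicator, dist_comm]
  have e2 : ∫⁻ w, (g w.2 * I w) ^ p ∂ν ≤ (∫⁻ z in Ω, g z ^ p) * min (volume M) v := by
    simp only [ENNReal.mul_rpow_of_nonneg _ _ hp.le, hIp p _ hp]
    rw [lintegral_prod_symm _ hm2.aemeasurable, 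
      ← lintegral_mul_const _ (hg.pow_const p)]
    refine lintegral_mono fun z => ?_
    simp only
    rw [lintegral_const_mul (g z ^ p) (f := fun x => I (x, z)) (hIm.comp (by fun_prop))]
    gcongr
    simp only [hsw]
    rw [lintegral_indicator_one Metric.isClosed_closedBall.measurableSet,
      Measure.restrict_apply Metric.isClosed_closedBall.measurableSet]
    exact le_min (measure_mono inter_subset_right) ((measure_mono inter_subset_left).trans (hv z))
  have e3 : ∫⁻ w, I w ^ q ∂ν ≤ volume M * v := by
    simp only [hIp q _ hq]
    rw [lintegral_prod _ hIm.aemeasurable]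
    calc _ ≤ ∫⁻ x in M, v := by
          refine lintegral_mono fun x => ?_
          simp only [I]
          rw [lintegral_indicator_one Metric.isClosed_closedBall.measurableSet]
          exact (Measure.restrict_apply_le _ _).trans (hv x)
      _ = _ := by rw [setLIntegral_const, mul_comm]
  refine (mul_le_mul' (ENNReal.rpow_le_rpow e2 (by positivity)) 
    (ENNReal.rpow_le_rpow e3 (by positivity))).trans ?_
  rw [ENNReal.mul_rpow_of_nonneg _ _ (by positivity : 0 ≤ 1 / p)]

/-- Interpolates `min m v ≤ m ^ θ * v ^ (1 - θ)`. The total power of `v` becomes `1 - θ / p`; with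
`v` of order `t ^ N` and the kernel factor `t ^ (-N)`, what remains is `t ^ (-N θ / p)`, integrable
at `0` exactly when `N θ < p`. -/
theorem rpow_min_mul_rpow_mul_le {p q θ : ℝ} (hpq : p.HolderConjugate q) (hθ0 : 0 ≤ θ) (hθ1 : θ ≤ 1)
    (m v : ℝ≥0∞) :
    min m v ^ (1 / p) * (m * v) ^ (1 / q) ≤ m ^ (1 / q + θ / p) * v ^ (1 / q + (1 - θ) / p) := by
  have hp := hpq.pos
  have hq := hpq.symm.pos
  have h1 : 0 ≤ 1 - θ := by linarith
  rw [ENNReal.mul_rpow_of_nonneg _ _ (by positivity : 0 ≤ 1 / q),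
    ENNReal.rpow_add_of_nonneg _ _ (by positivity) (by positivity),
    ENNReal.rpow_add_of_nonneg _ _ (by positivity) (by positivity)]
  have h2 : min m v ^ (1 / p) ≤ m ^ (θ / p) * v ^ ((1 - θ) / p) := by
    have : 1 / p = θ / p + (1 - θ) / p := by ring
    rw [this, ENNReal.rpow_add_of_nonneg _ _ (by positivity) (by positivity)]
    gcongr
    · exact min_le_left _ _
    · exact min_le_right _ _
  calc _ ≤ m ^ (θ / p) * v ^ ((1 - θ) / p) * (m ^ (1 / q) * v ^ (1 / q)) := by gcongr
    _ = _ := by ring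

theorem lintegral_Ioc_rpow_lt_top {a : ℝ} (ha : -1 < a) :
    ∫⁻ t in Ioc (0 : ℝ) 1, ENNReal.ofReal t ^ a < ⊤ := by
  have h := (intervalIntegral.intervalIntegrable_rpow' (a := 0) (b := 1) ha)
  rw [intervalIntegrable_iff_integrableOn_Ioc_of_le zero_le_one] at h
  refine lt_of_le_of_lt (setLIntegral_mono' measurableSet_Ioc fun t ht => ?_)
    h.hasFiniteIntegral
  rw [ENNReal.ofReal_rpow_of_pos ht.1, ← ofReal_norm]
  exact ENNReal.ofReal_le_ofReal (Real.le_norm_self _)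

/-- This plays the role of the Sobolev embedding. The pointwise cone estimate is integrated over
`M`, the order of integration is exchanged by Tonelli, and each scale `t` is treated by the Hölder
estimate for balls. -/
theorem exists_setLIntegral_enorm_le_of_conePoints {N : ℕ} {p q θ : ℝ} (hpq : p.HolderConjugate q)
    (hθ0 : 0 ≤ θ) (hθ1 : θ ≤ 1) (hθ : N * θ < p) (b : RN N) {δ : ℝ} (hδ : 0 < δ) :
    ∃ C : ℝ≥0, ∀ {Ω : Set (RN N)} {u : RN N → ℝ} {G : RN N → RN N}, MeasurableSet Ω →
      IsWeakGradient Ω u G → IntegrableOn u Ω → IntegrableOn G Ω →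
      ∀ M ⊆ conePoints Ω b δ, MeasurableSet M →
        ∫⁻ x in M, ‖u x‖ₑ ≤ C * (volume M * (∫⁻ z in Ω, ‖u z‖ₑ) +
          volume M ^ (1 / q + θ / p) * (∫⁻ z in Ω, ‖G z‖ₑ ^ p) ^ (1 / p)) := by
  have hp := hpq.pos
  have hq := hpq.symm.pos
  obtain ⟨C, hC⟩ := exists_ae_enorm_le_of_conePoints b hδ
  set R := ‖b‖ + δ
  have hR : 0 < R := by positivity
  set V := volume (Metric.closedBall (0 : RN N) R)
  have hV : V ≠ ⊤ := measure_closedBall_lt_top.ne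
  set e := 1 / q + (1 - θ) / p
  have he : 0 ≤ e := by have : 0 ≤ 1 - θ := by linarith
                        positivity
  have hJ : ∫⁻ t in Ioc (0 : ℝ) 1, ENNReal.ofReal t ^ (-(N * θ / p)) < ⊤ := by
    refine lintegral_Ioc_rpow_lt_top ?_
    have : N * θ / p < 1 := by rwa [div_lt_one hp]
    linarith
  set J := ∫⁻ t in Ioc (0 : ℝ) 1, ENNReal.ofReal t ^ (-(N * θ / p))
  have hD : (C : ℝ≥0∞) + C * V ^ e * J ≠ ⊤ := by
    refine ENNReal.add_ne_top.2 ⟨ENNReal.coe_ne_top, ?_⟩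
    exact ENNReal.mul_ne_top (ENNReal.mul_ne_top ENNReal.coe_ne_top
      (ENNReal.rpow_ne_top_of_nonneg he hV)) hJ.ne
  refine ⟨((C : ℝ≥0∞) + C * V ^ e * J).toNNReal, fun {Ω u G} hΩ h hu hG M hM hMm => ?_⟩
  rw [ENNReal.coe_toNNReal hD]
  -- A measurable version of `‖G‖ₑ`, so that Tonelli applies to a jointly measurable integrand.
  obtain ⟨g, hgm, hg⟩ := hG.aestronglyMeasurable.enorm
  have hgp : ∫⁻ z in Ω, ‖G z‖ₑ ^ p = ∫⁻ z in Ω, g z ^ p :=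
    lintegral_congr_ae (hg.mono fun z hz => by simp only [hz])
  set m := volume M
  set A := (∫⁻ z in Ω, g z ^ p) ^ (1 / p)
  have hball : Measurable (fun w : (RN N × ℝ) × RN N => 
      (Metric.closedBall w.1.1 (R * w.1.2)).indicator (1 : RN N → ℝ≥0∞) w.2) := by
    have : (fun w : (RN N × ℝ) × RN N => 
      (Metric.closedBall w.1.1 (R * w.1.2)).indicator (1 : RN N → ℝ≥0∞) w.2)
        = {w : (RN N × ℝ) × RN N | dist w.2 w.1.1 ≤ R * w.1.2}.indicator 1 := by
      ext w
      simp [indicator]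
    rw [this]
    exact measurable_one.indicator (isClosed_le (by fun_prop) (by fun_prop)).measurableSet
  have hmeas : Measurable (fun w : RN N × ℝ => ∫⁻ z in Ω, g z * (C * (ENNReal.ofReal w.2 ^ N)⁻¹ *
          (Metric.closedBall w.1 (R * w.2)).indicator 1 z)) := by
    refine Measurable.lintegral_prod_right' (f := fun w : (RN N × ℝ) × RN N =>
      g w.2 * ((C : ℝ≥0∞) * (ENNReal.ofReal w.1.2 ^ N)⁻¹ *
          (Metric.closedBall w.1.1 (R * w.1.2)).indicator 1 w.2)) ?_
    exact (hgm.comp measurable_snd).mul ((by fun_prop : Measurable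
      (fun w : (RN N × ℝ) × RN N => (C : ℝ≥0∞) * (ENNReal.ofReal w.1.2 ^ N)⁻¹)).mul hball)
  have hpt : ∀ t ∈ Ioc (0 : ℝ) 1, ∫⁻ x in M, ∫⁻ z in Ω, g z * (C * (ENNReal.ofReal t ^ N)⁻¹ *
          (Metric.closedBall x (R * t)).indicator 1 z) 
      ≤ C * V ^ e * (m ^ (1 / q + θ / p) * A) * ENNReal.ofReal t ^ (-(N * θ / p)) := by
    intro t ht
    set T := ENNReal.ofReal t
    have hT0 : T ≠ 0 := by simpa [T] using ht.1
    have hTt : T ≠ ⊤ := ENNReal.ofReal_ne_top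
    have hc : C * (T ^ N)⁻¹ ≠ ⊤ := ENNReal.mul_ne_top ENNReal.coe_ne_top 
      (ENNReal.inv_ne_top.2 (pow_ne_zero _ hT0))
    have hI : ∀ x z, g z * (C * (T ^ N)⁻¹ * (Metric.closedBall x (R * t)).indicator 1 z)
        = C * (T ^ N)⁻¹ * (g z * (Metric.closedBall x (R * t)).indicator 1 z) := by
      intros; ring
    simp_rw [hI, lintegral_const_mul' _ _ hc]
    calc _ ≤ C * (T ^ N)⁻¹ * (A * (m ^ (1 / q + θ / p) * (V * T ^ N) ^ e)) := by
          gcongr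
          refine (lintegral_lintegral_closedBall_le hpq hgm (v := V * T ^ N)
            fun x => (volume_closedBall_mul x hR.le ht.1.le).le).trans ?_
          rw [mul_assoc]
          exact mul_le_mul' le_rfl (rpow_min_mul_rpow_mul_le hpq hθ0 hθ1 _ _)
      _ = C * V ^ e * (m ^ (1 / q + θ / p) * A) * ((T ^ N)⁻¹ * (T ^ N) ^ e) := by
          rw [ENNReal.mul_rpow_of_nonneg _ _ he]; ring
      _ = _ := by
          congr 1
          rw [← ENNReal.rpow_natCast, ← ENNReal.rpow_neg, ← ENNReal.rpow_mul,
            ← ENNReal.rpow_add _ _ hT0 hTt]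
          congr 1
          have := hpq.inv_add_inv_eq_one
          simp only [e, one_div]
          rw [show q⁻¹ = 1 - p⁻¹ by linarith]
          ring
  calc ∫⁻ x in M, ‖u x‖ₑ 
      ≤ ∫⁻ x in M, (C * (∫⁻ z in Ω, ‖u z‖ₑ) +
        ∫⁻ t in Ioc (0 : ℝ) 1, ∫⁻ z in Ω, g z * (C * (ENNReal.ofReal t ^ N)⁻¹ *
          (Metric.closedBall x (R * t)).indicator 1 z)) := by
        refine setLIntegral_mono_ae' hMm ?_
        filter_upwards [hC hΩ h hu hG] with x hx hxM
        refine (hx (hM hxM)).trans (le_of_eq ?_)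
        congr 1
        refine lintegral_congr fun t => lintegral_congr_ae (hg.mono fun z hz => ?_)
        simp only [hz]
    _ = C * (∫⁻ z in Ω, ‖u z‖ₑ) * m + ∫⁻ t in Ioc (0 : ℝ) 1, ∫⁻ x in M, ∫⁻ z in Ω, 
          g z * (C * (ENNReal.ofReal t ^ N)⁻¹ * (Metric.closedBall x (R * t)).indicator 1 z) := by
        rw [lintegral_add_left measurable_const, setLIntegral_const, lintegral_lintegral_swap]
        exact hmeas.aemeasurable
    _ ≤ C * (∫⁻ z in Ω, ‖u z‖ₑ) * m + C * V ^ e * (m ^ (1 / q + θ / p) * A) * J := by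
        gcongr
        rw [← lintegral_const_mul _ (by fun_prop)]
        exact setLIntegral_mono' measurableSet_Ioc hpt
    _ ≤ _ := by
        rw [hgp]
        calc _ = C * (m * ∫⁻ z in Ω, ‖u z‖ₑ) + C * V ^ e * J * (m ^ (1 / q + θ / p) * A) := by ring
          _ ≤ _ := by
            rw [mul_add]
            gcongr
            · exact le_self_add
            · exact le_add_self

/-! ### The cone property of Lipschitz domains -/

theorem exists_conePoints_of_isOpen {N : ℕ} {Ω : Set (RN N)} (hΩ : IsOpen Ω) {x₀ : RN N}
    (hx₀ : x₀ ∈ Ω) :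
    ∃ (b : RN N) (δ ρ : ℝ), 0 < δ ∧ 0 < ρ ∧ Ω ∩ Metric.ball x₀ ρ ⊆ conePoints Ω b δ := by
  obtain ⟨r, hr, hrΩ⟩ := Metric.isOpen_iff.1 hΩ x₀ hx₀
  -- With axis `0` the cone degenerates to a ball around its vertex.
  refine ⟨0, r / 2, r / 2, by positivity, by positivity, fun x hx => ⟨hx.1, fun s hs z hz => ?_⟩⟩
  refine hrΩ ?_
  have h1 : dist z x ≤ s * (r / 2) := by simpa using hz
  have h2 : dist x x₀ < r / 2 := hx.2
  have h3 : s * (r / 2) ≤ 1 * (r / 2) := by gcongr; exact hs.2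
  rw [Metric.mem_ball]
  linarith [dist_triangle z x x₀]

theorem HasLipschitzBoundary.exists_conePoints {N : ℕ} {Ω : Set (RN N)}
    (hΩ : HasLipschitzBoundary Ω) {x₀ : RN N} (hx₀ : x₀ ∈ frontier Ω) :
    ∃ (b : RN N) (δ ρ : ℝ), 0 < δ ∧ 0 < ρ ∧ Ω ∩ Metric.ball x₀ ρ ⊆ conePoints Ω b δ := by
  obtain ⟨e, he, r, hr, K, g, hg, hgr⟩ := hΩ x₀ hx₀
  have hK : (0 : ℝ) ≤ K := K.2
  -- The cone has axis `h • e`. A deviation of size `s * δ` moves the component orthogonal to `e` by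
  -- at most `2 * (s * δ)` and so raises `g` by at most `2 * K * (s * δ)`, while the height rises by
  -- at least `s * h - s * δ`; hence `h = (2 + 2 * K) * δ` suffices. The value of `δ` makes `h + δ =
  -- r / 2`, so cones with vertex within `r / 2` of `x₀` stay in the ball of radius `r`.
  set δ : ℝ := r / (2 * (3 + 2 * K)) with hδdef
  have hδ : 0 < δ := by positivity
  set h : ℝ := (2 + 2 * K) * δ with hh
  have hsum : h + δ = r / 2 := by rw [hh, hδdef]; field_simp; ring
  have hh0 : 0 ≤ h := by positivity
  refine ⟨h • e, δ, r / 2, hδ, by positivity, fun x hx => ⟨hx.1, fun s hs z hz => ?_⟩⟩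
  set w := z - (x + s • h • e) with hw
  have hwn : ‖w‖ ≤ s * δ := by rwa [mem_closedBall_iff_norm] at hz
  have hzx : z = x + (s * h) • e + w := by rw [hw, smul_smul]; abel
  have hx0 : dist x x₀ < r / 2 := hx.2
  have hs0 := hs.1
  have hxb : x ∈ Metric.ball x₀ r := by rw [Metric.mem_ball]; linarith
  have hzb : z ∈ Metric.ball x₀ r := by
    have h1 : dist z x ≤ s * h + s * δ := by
      rw [dist_eq_norm, hzx, add_assoc, add_sub_cancel_left]
      refine (norm_add_le _ _).trans ?_
      rw [norm_smul, he, mul_one, Real.norm_of_nonneg (by positivity)]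
      linarith
    have h2 : s * h + s * δ ≤ r / 2 := by
      rw [← mul_add, hsum]
      nlinarith [hs.2]
    rw [Metric.mem_ball]
    linarith [dist_triangle z x x₀]
  have hxg := (hgr x hxb).1 hx.1
  rw [hgr z hzb]
  have hee : inner ℝ e e = (1 : ℝ) := by rw [real_inner_self_eq_norm_sq, he]; norm_num
  have hiz : inner ℝ e z = inner ℝ e x + s * h + inner ℝ e w := by
    rw [hzx, inner_add_right, inner_add_right, inner_smul_right, hee, mul_one]
  have hiw : |inner ℝ e w| ≤ ‖w‖ := by
    simpa [he] using abs_real_inner_le_norm e w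
  have hproj : (z - (inner ℝ e z) • e) - (x - (inner ℝ e x) • e) = w - (inner ℝ e w) • e := by
    rw [hiz, hzx]
    simp only [add_smul]
    abel
  have hlip := hg.dist_le_mul (z - (inner ℝ e z) • e) (x - (inner ℝ e x) • e)
  rw [dist_eq_norm, dist_eq_norm, hproj] at hlip
  have hpn : ‖w - (inner ℝ e w) • e‖ ≤ 2 * (s * δ) := by
    refine (norm_sub_le _ _).trans ?_
    rw [norm_smul, he, mul_one, Real.norm_eq_abs]
    linarith
  have h5 : g (z - (inner ℝ e z) • e) - g (x - (inner ℝ e x) • e) ≤ K * (2 * (s * δ)) :=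
    (Real.le_norm_self _).trans (hlip.trans (by gcongr))
  have h6 : s * h = 2 * (s * δ) + K * (2 * (s * δ)) := by rw [hh]; ring
  have h7 := neg_le_of_abs_le (hiw.trans hwn)
  have h8 : 0 < s * δ := by positivity
  linarith

/-- A bounded open set with Lipschitz boundary is covered by finitely many balls such that the
points in each of them are vertices of congruent truncated cones contained in the set. -/
theorem exists_finite_conePoints_cover {N : ℕ} {Ω : Set (RN N)} (hΩo : IsOpen Ω)
    (hΩb : Bornology.IsBounded Ω) (hΩl : HasLipschitzBoundary Ω) :
    ∃ (T : Finset (RN N)) (b : RN N → RN N) (δ ρ : RN N → ℝ), (∀ i, 0 < δ i) ∧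
      (∀ i ∈ T, Ω ∩ Metric.ball i (ρ i) ⊆ conePoints Ω (b i) (δ i)) ∧
      Ω ⊆ ⋃ i ∈ T, Metric.ball i (ρ i) := by
  have h : ∀ x₀ : RN N, ∃ (b : RN N) (δ ρ : ℝ), 0 < δ ∧ 0 < ρ ∧
      (x₀ ∈ closure Ω → Ω ∩ Metric.ball x₀ ρ ⊆ conePoints Ω b δ) := by
    intro x₀
    by_cases hx : x₀ ∈ closure Ω
    · rw [closure_eq_self_union_frontier] at hx
      rcases hx with hx | hx
      · obtain ⟨b, δ, ρ, h1, h2, h3⟩ := exists_conePoints_of_isOpen hΩo hx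
        exact ⟨b, δ, ρ, h1, h2, fun _ => h3⟩
      · obtain ⟨b, δ, ρ, h1, h2, h3⟩ := hΩl.exists_conePoints hx
        exact ⟨b, δ, ρ, h1, h2, fun _ => h3⟩
    · exact ⟨0, 1, 1, one_pos, one_pos, fun h => absurd h hx⟩
  choose b δ ρ hδ hρ hcone using h
  obtain ⟨T, hT, hcov⟩ := hΩb.isCompact_closure.elim_nhds_subcover (fun x => Metric.ball x (ρ x))
    (fun x _ => Metric.ball_mem_nhds x (hρ x))
  exact ⟨T, b, δ, ρ, hδ, fun i hi => hcone i (hT i hi), subset_closure.trans hcov⟩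

theorem exists_setLIntegral_enorm_le {N : ℕ} {p q θ : ℝ} (hpq : p.HolderConjugate q)
    (hθ0 : 0 ≤ θ) (hθ1 : θ ≤ 1) (hθ : N * θ < p) {Ω : Set (RN N)} (hΩo : IsOpen Ω)
    (hΩb : Bornology.IsBounded Ω) (hΩl : HasLipschitzBoundary Ω) :
    ∃ C : ℝ≥0, ∀ {u : RN N → ℝ} {G : RN N → RN N}, IsWeakGradient Ω u G → IntegrableOn u Ω →
      IntegrableOn G Ω → ∀ M ⊆ Ω, MeasurableSet M →
        ∫⁻ x in M, ‖u x‖ₑ ≤ C * (volume M * (∫⁻ z in Ω, ‖u z‖ₑ) +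
          volume M ^ (1 / q + θ / p) * (∫⁻ z in Ω, ‖G z‖ₑ ^ p) ^ (1 / p)) := by
  have hp := hpq.pos
  have hq := hpq.symm.pos
  obtain ⟨T, b, δ, ρ, hδ, hcone, hcov⟩ := exists_finite_conePoints_cover hΩo hΩb hΩl
  choose C hC using fun i => exists_setLIntegral_enorm_le_of_conePoints hpq hθ0 hθ1 hθ (b i) (hδ i)
  refine ⟨∑ i ∈ T, C i, fun {u G} h hu hG M hM hMm => ?_⟩
  have hMT : M ⊆ ⋃ i : T, M ∩ Metric.ball (i : RN N) (ρ i) := by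
    intro x hx
    have := hcov (hM hx)
    simp only [mem_iUnion] at this ⊢
    obtain ⟨i, hi, hxi⟩ := this
    exact ⟨⟨i, hi⟩, hx, hxi⟩
  calc ∫⁻ x in M, ‖u x‖ₑ ≤ ∫⁻ x in ⋃ i : T, M ∩ Metric.ball (i : RN N) (ρ i), ‖u x‖ₑ :=
        lintegral_mono_set hMT
    _ ≤ ∑ i ∈ T, ∫⁻ x in M ∩ Metric.ball i (ρ i), ‖u x‖ₑ := by
        refine (lintegral_iUnion_le _ _).trans (le_of_eq ?_)
        rw [tsum_fintype, Finset.sum_coe_sort T fun i => ∫⁻ x in M ∩ Metric.ball i (ρ i), ‖u x‖ₑ]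
    _ ≤ ∑ i ∈ T, C i * (volume M * (∫⁻ z in Ω, ‖u z‖ₑ) +
          volume M ^ (1 / q + θ / p) * (∫⁻ z in Ω, ‖G z‖ₑ ^ p) ^ (1 / p)) := by
        refine Finset.sum_le_sum fun i hi => ?_
        refine (hC i hΩo.measurableSet h hu hG _ ((inter_subset_inter_left _ hM).trans (hcone i hi))
          (hMm.inter measurableSet_ball)).trans ?_
        gcongr
        · exact inter_subset_left
        · exact inter_subset_left
    _ = _ := by rw [← Finset.sum_mul]; push_cast; rfl

/-! ### Pratt's lemma and the chain rule for weak gradients -/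

/-- Pratt's lemma: dominated convergence with varying dominating functions. -/
theorem tendsto_integral_of_tendsto_integral_bound {α : Type*} [MeasurableSpace α] {μ : Measure α}
    {h H : ℕ → α → ℝ} {h' H' : α → ℝ} (hm : ∀ n, AEStronglyMeasurable (h n) μ)
    (hH : ∀ n, Integrable (H n) μ) (hH' : Integrable H' μ) (hle : ∀ n, ∀ᵐ x ∂μ, |h n x| ≤ H n x)
    (hlim : ∀ᵐ x ∂μ, Tendsto (fun n => h n x) atTop (𝓝 (h' x)))
    (hHlim : ∀ᵐ x ∂μ, Tendsto (fun n => H n x) atTop (𝓝 (H' x)))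
    (hint : Tendsto (fun n => ∫ x, H n x ∂μ) atTop (𝓝 (∫ x, H' x ∂μ))) :
    Tendsto (fun n => ∫ x, h n x ∂μ) atTop (𝓝 (∫ x, h' x ∂μ)) := by
  have hle' : ∀ᵐ x ∂μ, ∀ n, |h n x| ≤ H n x := ae_all_iff.2 hle
  have hh' : ∀ᵐ x ∂μ, |h' x| ≤ H' x := by
    filter_upwards [hle', hlim, hHlim] with x h1 h2 h3
    exact le_of_tendsto_of_tendsto' h2.abs h3 h1
  have hi : ∀ n, Integrable (h n) μ := fun n => (hH n).mono' (hm n) (hle n)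
  -- Clamping `h n` to `[-H', H']` allows ordinary dominated convergence. The error is at most `(H n
  -- - H')⁺ = (H n - H') + (H' - H n)⁺`: the first integral tends to `0` by hypothesis, the second
  -- by domination by `H'`, as `H n ≥ 0`.
  set k : ℕ → α → ℝ := fun n x => max (-H' x) (min (h n x) (H' x)) with hk
  have hkm : ∀ n, AEStronglyMeasurable (k n) μ := fun n =>
    hH'.aestronglyMeasurable.neg.sup ((hm n).inf hH'.aestronglyMeasurable)
  have hkb : ∀ n, ∀ᵐ x ∂μ, ‖k n x‖ ≤ H' x := by
    intro n
    filter_upwards [hh'] with x hx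
    have := (abs_nonneg _).trans hx
    rw [Real.norm_eq_abs, abs_le]
    exact ⟨le_max_left _ _, max_le (by linarith) (min_le_right _ _)⟩
  have hki : ∀ n, Integrable (k n) μ := fun n => hH'.mono' (hkm n) (hkb n)
  have hk1 : Tendsto (fun n => ∫ x, k n x ∂μ) atTop (𝓝 (∫ x, h' x ∂μ)) := by
    refine tendsto_integral_of_dominated_convergence H' hkm hH' hkb ?_
    filter_upwards [hlim, hh'] with x h1 h2
    have h3 := (tendsto_const_nhds (x := -H' x)).max (h1.min (tendsto_const_nhds (x := H' x)))
    rw [abs_le] at h2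
    rwa [min_eq_left h2.2, max_eq_right h2.1] at h3
  have hp : Tendsto (fun n => ∫ x, max (H' x - H n x) 0 ∂μ) atTop (𝓝 (∫ _, (0 : ℝ) ∂μ)) := by
    refine tendsto_integral_of_dominated_convergence H'
      (fun n => (hH'.sub (hH n)).pos_part.aestronglyMeasurable) hH' ?_ ?_
    · intro n
      filter_upwards [hle n, hh'] with x h1 h2
      have h3 := (abs_nonneg _).trans h1
      have h4 := (abs_nonneg _).trans h2
      rw [Real.norm_of_nonneg (le_max_right _ _)]
      exact max_le (by linarith) h4
    · filter_upwards [hHlim] with x h1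
      have h3 := ((tendsto_const_nhds (x := H' x)).sub h1).max (tendsto_const_nhds (x := (0 : ℝ)))
      simpa using h3
  rw [integral_zero] at hp
  have hd : Tendsto (fun n => ∫ x, h n x ∂μ - ∫ x, k n x ∂μ) atTop (𝓝 0) := by
    have hb : Tendsto (fun n => (∫ x, H n x ∂μ - ∫ x, H' x ∂μ) + ∫ x, max (H' x - H n x) 0 ∂μ)
        atTop (𝓝 0) := by
      simpa using (hint.sub_const (∫ x, H' x ∂μ)).add hp
    refine squeeze_zero_norm (fun n => ?_) hb
    have i1 : Integrable (fun x => H n x - H' x) μ := (hH n).sub hH'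
    have i2 : Integrable (fun x => max (H' x - H n x) 0) μ := (hH'.sub (hH n)).pos_part
    rw [← integral_sub (hi n) (hki n), ← integral_sub (hH n) hH', ← integral_add i1 i2]
    refine norm_integral_le_of_norm_le (i1.add i2) ?_
    filter_upwards [hle n, hh'] with x h1 h2
    have h4 := (abs_nonneg _).trans h2
    rw [abs_le] at h1
    simp only [Real.norm_eq_abs, hk]
    rcases le_total (h n x) (H' x) with h5 | h5
    · rw [min_eq_left h5]
      rcases le_total (-H' x) (h n x) with h6 | h6
      · rw [max_eq_right h6, sub_self, abs_zero]
        linarith [le_max_left (H' x - H n x) 0]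
      · rw [max_eq_left h6, abs_of_nonpos (by linarith)]
        linarith [le_max_right (H' x - H n x) 0]
    · rw [min_eq_right h5, max_eq_right (by linarith), abs_of_nonneg (by linarith)]
      linarith [le_max_right (H' x - H n x) 0]
  simpa using hd.add hk1

open scoped Convolution in
theorem fderiv_convolution_apply {N : ℕ} {ρ U : RN N → ℝ} (hρ : ContDiff ℝ ∞ ρ)
    (hρc : HasCompactSupport ρ) (hU : LocallyIntegrable U) (x v : RN N) :
    fderiv ℝ (ρ ⋆[ContinuousLinearMap.lsmul ℝ ℝ] U) x v = ∫ t, fderiv ℝ ρ (x - t) v * U t := by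
  have h1 := hρc.hasFDerivAt_convolution_left (ContinuousLinearMap.lsmul ℝ ℝ)
    (hρ.of_le (by norm_cast)) hU x
  rw [h1.fderiv]
  have hex : ConvolutionExistsAt (fderiv ℝ ρ) U x
      ((ContinuousLinearMap.lsmul ℝ ℝ : ℝ →L[ℝ] ℝ →L[ℝ] ℝ).precompL (RN N)) volume :=
    (hρc.fderiv ℝ).convolutionExists_left _ (hρ.continuous_fderiv (by simp)) hU x
  rw [convolution_eq_swap, ContinuousLinearMap.integral_apply]
  · rfl
  · exact hex.integrable_swap

open scoped Convolution in
/-- Where the mollifying kernel only sees points of `Ω`, the gradient of the mollification is the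
mollification of the weak gradient. -/
theorem IsWeakGradient.fderiv_convolution {N : ℕ} {Ω : Set (RN N)} {u : RN N → ℝ}
    {G : RN N → RN N} (h : IsWeakGradient Ω u G) (hΩ : MeasurableSet Ω) (hu : IntegrableOn u Ω)
    {ρ : RN N → ℝ} (hρ : ContDiff ℝ ∞ ρ) {r : ℝ}
    (hρs : tsupport ρ ⊆ Metric.closedBall 0 r) {x : RN N} (hx : Metric.closedBall x r ⊆ Ω)
    (v : RN N) :
    fderiv ℝ (ρ ⋆[ContinuousLinearMap.lsmul ℝ ℝ] Ω.indicator u) x v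
      = (ρ ⋆[ContinuousLinearMap.lsmul ℝ ℝ] Ω.indicator fun z => inner ℝ (G z) v) x := by
  have hρc : HasCompactSupport ρ := HasCompactSupport.of_support_subset_isCompact
    (isCompact_closedBall _ _) ((subset_tsupport _).trans hρs)
  have hψs : tsupport (fun z => ρ (x - z)) ⊆ Metric.closedBall x r := by
    refine closure_minimal (fun z hz => ?_) Metric.isClosed_closedBall
    have := hρs (subset_tsupport _ (show ρ (x - z) ≠ 0 from hz))
    rwa [mem_closedBall_zero_iff, ← dist_eq_norm, dist_comm] at this
  have hψd : ContDiff ℝ ∞ (fun z => ρ (x - z)) := hρ.comp (by fun_prop)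
  have hψc : HasCompactSupport (fun z => ρ (x - z)) :=
    HasCompactSupport.of_support_subset_isCompact (isCompact_closedBall _ _)
      ((subset_tsupport _).trans hψs)
  have key := h.integral_eq _ hψd hψc (hψs.trans hx) v
  have hfd : ∀ z, fderiv ℝ (fun z => ρ (x - z)) z v = -fderiv ℝ ρ (x - z) v := by
    intro z
    have h1 : HasFDerivAt (fun z : RN N => x - z) (-ContinuousLinearMap.id ℝ (RN N)) z :=
      (hasFDerivAt_id z).const_sub x
    have h2 := ((hρ.differentiable (by simp)) (x - z)).hasFDerivAt.comp z h1
    have h3 : HasFDerivAt (fun z => ρ (x - z)) _ z := h2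
    rw [h3.fderiv]
    simp
  simp_rw [hfd, mul_neg, integral_neg, neg_inj] at key
  rw [fderiv_convolution_apply hρ hρc ((integrable_indicator_iff hΩ).2 hu).locallyIntegrable,
    convolution_lsmul_swap]
  have e1 : ∀ t, fderiv ℝ ρ (x - t) v * Ω.indicator u t
      = Ω.indicator (fun t => u t * fderiv ℝ ρ (x - t) v) t := by
    intro t
    by_cases ht : t ∈ Ω <;> simp [ht, mul_comm]
  have e2 : ∀ t, ρ (x - t) • Ω.indicator (fun z => inner ℝ (G z) v) t
      = Ω.indicator (fun t => ρ (x - t) * inner ℝ (G t) v) t := by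
    intro t
    by_cases ht : t ∈ Ω <;> simp [ht]
  simp_rw [e1, e2, integral_indicator hΩ]
  exact key

open scoped Convolution in
/-- The chain rule for weak gradients. -/
theorem IsWeakGradient.comp {N : ℕ} {Ω : Set (RN N)} {u : RN N → ℝ} {G : RN N → RN N}
    (h : IsWeakGradient Ω u G) (hΩ : IsOpen Ω) (hΩf : volume Ω ≠ ⊤) (hu : IntegrableOn u Ω)
    (hG : IntegrableOn G Ω) {F F' : ℝ → ℝ} (hF : ∀ t, HasDerivAt F (F' t) t) (hF' : Continuous F') {C : ℝ}
    (hFC : ∀ t, |F t| ≤ C) (hFC' : ∀ t, |F' t| ≤ C) :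
    IsWeakGradient Ω (fun x => F (u x)) (fun x => F' (u x) • G x) := by
  have hFc : Continuous F := continuous_iff_continuousAt.2 fun t => (hF t).continuousAt
  have hΩm := hΩ.measurableSet
  have hC0 : 0 ≤ C := (abs_nonneg _).trans (hFC 0)
  refine ⟨?_, ?_, ?_⟩
  · refine IntegrableOn.locallyIntegrableOn ?_
    exact (integrableOn_const hΩf (C := C)).mono'
      (hFc.comp_aestronglyMeasurable hu.aestronglyMeasurable) (Eventually.of_forall fun x => hFC _)
  · refine IntegrableOn.locallyIntegrableOn ?_
    exact hG.bdd_smul C (hF'.comp_aestronglyMeasurable hu.aestronglyMeasurable)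
      (Eventually.of_forall fun x => hFC' _)
  intro φ hφ hφc hφs v
  set U : RN N → ℝ := Ω.indicator u
  set g : RN N → ℝ := Ω.indicator fun z => inner ℝ (G z) v
  have hUi : Integrable U := (integrable_indicator_iff hΩm).2 hu
  have hgi : Integrable g := (integrable_indicator_iff hΩm).2 (hG.inner_const v)
  -- For mollifiers of radius at most `r`, the kernel centred at a point of the support of `φ` sees
  -- only `Ω`, so there the gradient commutes with mollification.
  obtain ⟨r, hr, hrΩ⟩ := hφc.isCompact.exists_cthickening_subset_open hΩ hφs
  -- Keeping the ratio of outer to inner radius fixed is what gives almost everywhere convergence of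
  -- the mollifications.
  let B : ℕ → ContDiffBump (0 : RN N) := fun n =>
    ⟨r / (n + 1) / 2, r / (n + 1), by positivity, half_lt_self (by positivity)⟩
  have hBr : ∀ n, (B n).rOut ≤ r := fun n => 
    div_le_self hr.le (by linarith [(Nat.cast_nonneg n : (0 : ℝ) ≤ n)])
  have hB0 : Tendsto (fun n => (B n).rOut) atTop (𝓝 0) :=
    tendsto_const_nhds.div_atTop (tendsto_atTop_add_const_right _ _ tendsto_natCast_atTop_atTop)
  have hBK : ∀ᶠ n in atTop, (B n).rOut ≤ 2 * (B n).rIn := Eventually.of_forall fun n => by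
    simp only [B]; linarith
  set ρ : ℕ → RN N → ℝ := fun n => (B n).normed volume
  have hρd : ∀ n, ContDiff ℝ ∞ (ρ n) := fun n => (B n).contDiff_normed (n := ⊤)
  have hρc : ∀ n, HasCompactSupport (ρ n) := fun n => (B n).hasCompactSupport_normed
  have hρs : ∀ n, tsupport (ρ n) ⊆ Metric.closedBall 0 r := fun n =>
    (B n).tsupport_normed_eq.subset.trans (Metric.closedBall_subset_closedBall (hBr n))
  have hρi : ∀ n, Integrable (ρ n) := fun n => (B n).integrable_normed
  set w : ℕ → RN N → ℝ := fun n => ρ n ⋆[ContinuousLinearMap.lsmul ℝ ℝ] U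
  set gn : ℕ → RN N → ℝ := fun n => ρ n ⋆[ContinuousLinearMap.lsmul ℝ ℝ] g
  -- The varying dominating function for Pratt's lemma: it bounds `|gn n|`, converges almost
  -- everywhere to `|g|`, and has the same integral as `|g|` for every `n`. Thus almost everywhere
  -- convergence of mollifications suffices.
  set An : ℕ → RN N → ℝ := fun n => ρ n ⋆[ContinuousLinearMap.lsmul ℝ ℝ] (fun x => |g x|)
  have hwd : ∀ n, ContDiff ℝ ∞ (w n) := fun n =>
    (hρc n).contDiff_convolution_left _ (n := ⊤) (hρd n) hUi.locallyIntegrable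
  have hgc : ∀ n, Continuous (gn n) := fun n =>
    (hρc n).continuous_convolution_left _ (hρd n).continuous hgi.locallyIntegrable
  have hAi : ∀ n, Integrable (An n) := fun n => (hρi n).integrable_convolution _ hgi.abs
  have hgA : ∀ n x, |gn n x| ≤ An n x := by
    intro n x
    simp only [gn, An, convolution_def]
    rw [← Real.norm_eq_abs]
    refine (norm_integral_le_integral_norm _).trans (le_of_eq ?_)
    congr 1; ext t
    simp [abs_of_nonneg ((B n).nonneg_normed t), ρ]
  have hw_lim := ContDiffBump.ae_convolution_tendsto_right_of_locallyIntegrable hB0 hBK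
    hUi.locallyIntegrable
  have hg_lim := ContDiffBump.ae_convolution_tendsto_right_of_locallyIntegrable hB0 hBK
    hgi.locallyIntegrable
  have hA_lim := ContDiffBump.ae_convolution_tendsto_right_of_locallyIntegrable hB0 hBK
    hgi.abs.locallyIntegrable
  have hAint : ∀ n, ∫ x, An n x = ∫ x, |g x| := by
    intro n
    simp only [An]
    rw [integral_convolution _ (hρi n) hgi.abs, (B n).integral_normed]
    simp
  have hφ0 : ∀ x ∉ Ω, φ x = 0 := fun x hx => image_eq_zero_of_notMem_tsupport fun h => hx (hφs h)
  have hdφ0 : ∀ x ∉ Ω, fderiv ℝ φ x v = 0 := fun x hx => by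
    rw [image_eq_zero_of_notMem_tsupport (f := fderiv ℝ φ) fun h =>
      hx (hφs (tsupport_fderiv_subset ℝ h))]
    rfl
  have hdφc : Continuous (fun x => fderiv ℝ φ x v) :=
    (hφ.continuous_fderiv (by simp)).clm_apply continuous_const
  have hdφi : Integrable (fun x => fderiv ℝ φ x v) :=
    hdφc.integrable_of_hasCompactSupport (hφc.fderiv_apply ℝ v)
  obtain ⟨Cφ, hCφ⟩ := hφ.continuous.bounded_above_of_compact_support hφc
  have hCφ0 : 0 ≤ Cφ := (norm_nonneg _).trans (hCφ 0)
  have hFw : ∀ n x, HasFDerivAt (fun x => F (w n x)) (F' (w n x) • fderiv ℝ (w n) x) x :=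
    fun n x => (hF _).comp_hasFDerivAt x ((hwd n).differentiable (by simp) x).hasFDerivAt
  have hibp : ∀ n, ∫ x, F (w n x) * fderiv ℝ φ x v = -∫ x, φ x * (F' (w n x) * gn n x) := by
    intro n
    have hc1 : Continuous (fun x => fderiv ℝ (fun x => F (w n x)) x v) := by
      simp_rw [(hFw n _).fderiv]
      exact ((hF'.comp (hwd n).continuous).smul 
        ((hwd n).continuous_fderiv (by simp))).clm_apply continuous_const
    have hc2 : Continuous (fun x => F (w n x)) := hFc.comp (hwd n).continuous
    rw [integral_mul_fderiv_eq_neg_fderiv_mul_of_integrable]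
    · congr 2
      ext x
      rw [(hFw n x).fderiv]
      by_cases hx : x ∈ tsupport φ
      · have : fderiv ℝ (w n) x v = gn n x := h.fderiv_convolution hΩm hu (hρd n) (hρs n)
          ((Metric.closedBall_subset_cthickening hx r).trans hrΩ) v
        simp [this]
        ring
      · rw [image_eq_zero_of_notMem_tsupport hx]
        simp
    · exact (hc1.mul hφ.continuous).integrable_of_hasCompactSupport hφc.mul_left
    · exact (hc2.mul hdφc).integrable_of_hasCompactSupport (hφc.fderiv_apply ℝ v).mul_left
    · exact (hc2.mul hφ.continuous).integrable_of_hasCompactSupport hφc.mul_left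
    · exact fun x _ => (hFw n x).differentiableAt
    · exact fun x _ => hφ.differentiable (by simp) x
  have hL : Tendsto (fun n => ∫ x, F (w n x) * fderiv ℝ φ x v) atTop
      (𝓝 (∫ x, F (U x) * fderiv ℝ φ x v)) := by
    refine tendsto_integral_of_dominated_convergence (fun x => C * |fderiv ℝ φ x v|)
      (fun n => ((hFc.comp (hwd n).continuous).mul hdφc).aestronglyMeasurable)
      (hdφi.abs.const_mul C) (fun n => Eventually.of_forall fun x => ?_) ?_
    · rw [Real.norm_eq_abs, abs_mul]
      gcongr
      exact hFC _
    · filter_upwards [hw_lim] with x hx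
      exact ((hFc.tendsto _).comp hx).mul_const _
  have hR : Tendsto (fun n => ∫ x, φ x * (F' (w n x) * gn n x)) atTop
      (𝓝 (∫ x, φ x * (F' (U x) * g x))) := by
    refine tendsto_integral_of_tendsto_integral_bound (H := fun n x => Cφ * (C * An n x))
      (H' := fun x => Cφ * (C * |g x|))
      (fun n => (hφ.continuous.mul
        ((hF'.comp (hwd n).continuous).mul (hgc n))).aestronglyMeasurable)
      (fun n => ((hAi n).const_mul C).const_mul Cφ) ((hgi.abs.const_mul C).const_mul Cφ)
      (fun n => Eventually.of_forall fun x => ?_) ?_ ?_ ?_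
    · rw [abs_mul, abs_mul]
      gcongr
      · exact hCφ x
      · exact hFC' _
      · exact hgA n x
    · filter_upwards [hw_lim, hg_lim] with x hx hx'
      exact (((hF'.tendsto _).comp hx).mul hx').const_mul _
    · filter_upwards [hA_lim] with x hx
      exact (hx.const_mul _).const_mul _
    · simp_rw [integral_const_mul, hAint]
      exact tendsto_const_nhds
  have hfin := tendsto_nhds_unique hL (by simp_rw [hibp]; exact hR.neg)
  rw [← setIntegral_eq_integral_of_forall_compl_eq_zero (s := Ω) (fun x hx => by simp [hdφ0 x hx]),
    ← setIntegral_eq_integral_of_forall_compl_eq_zero (s := Ω) (f := fun x => φ x * _)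
    (fun x hx => by simp [hφ0 x hx])] at hfin
  rw [setIntegral_congr_fun hΩm (g := fun x => F (U x) * fderiv ℝ φ x v)
    (fun x hx => by simp [U, hx]), hfin]
  congr 1
  refine setIntegral_congr_fun hΩm fun x hx => ?_
  simp [U, g, hx, inner_smul_left]

/-! ### Uniform convexity of `L^p` -/

theorem norm_half_add_rpow_le {E : Type*} [NormedAddCommGroup E] [NormedSpace ℝ E] {p : ℝ}
    (hp : 1 < p) (a b : E) : ‖(1 / 2 : ℝ) • (a + b)‖ ^ p ≤ (‖a‖ ^ p + ‖b‖ ^ p) / 2 := by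
  have h1 : ‖(1 / 2 : ℝ) • (a + b)‖ ≤ (1 / 2 : ℝ) • ‖a‖ + (1 / 2 : ℝ) • ‖b‖ := by
    rw [norm_smul, smul_eq_mul, smul_eq_mul, Real.norm_of_nonneg (by norm_num)]
    linarith [norm_add_le a b]
  refine (Real.rpow_le_rpow (norm_nonneg _) h1 (by linarith)).trans ?_
  refine ((convexOn_rpow hp.le).2 (norm_nonneg a) (norm_nonneg b) (by norm_num) (by norm_num)
    (by norm_num)).trans (le_of_eq ?_)
  simp only [smul_eq_mul]; ring

/-- For equal norms the strictness comes from the parallelogram law, for different norms from strict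
convexity of `x ↦ x ^ p`. -/
theorem norm_half_add_rpow_lt {E : Type*} [NormedAddCommGroup E] [InnerProductSpace ℝ E] {p : ℝ}
    (hp : 1 < p) {a b : E} (hab : a ≠ b) :
    ‖(1 / 2 : ℝ) • (a + b)‖ ^ p < (‖a‖ ^ p + ‖b‖ ^ p) / 2 := by
  have h0 : ‖(1 / 2 : ℝ) • (a + b)‖ = (1 / 2 : ℝ) * ‖a + b‖ := by
    rw [norm_smul, Real.norm_of_nonneg (by norm_num)]
  by_cases hn : ‖a‖ = ‖b‖
  · have h1 : ‖(1 / 2 : ℝ) • (a + b)‖ < ‖b‖ := by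
      have h2 := parallelogram_law_with_norm ℝ a b
      have h3 : 0 < ‖a - b‖ := norm_pos_iff.2 (sub_ne_zero.2 hab)
      rw [h0]
      rw [hn] at h2
      nlinarith [norm_nonneg b, norm_nonneg (a + b)]
    have := Real.rpow_lt_rpow (norm_nonneg _) h1 (by linarith : 0 < p)
    rw [hn]; linarith
  · have h1 : ‖(1 / 2 : ℝ) • (a + b)‖ ≤ (1 / 2 : ℝ) • ‖a‖ + (1 / 2 : ℝ) • ‖b‖ := by
      rw [h0, smul_eq_mul, smul_eq_mul]
      linarith [norm_add_le a b]
    refine (Real.rpow_le_rpow (norm_nonneg _) h1 (by linarith)).trans_lt ?_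
    refine ((strictConvexOn_rpow hp).2 (norm_nonneg a) (norm_nonneg b) hn (by norm_num)
      (by norm_num) (by norm_num)).trans_eq ?_
    simp only [smul_eq_mul]; ring

/-- Uniform convexity of `‖·‖ ^ p` on a Euclidean space, in homogeneous form. -/
theorem exists_norm_sub_rpow_le {E : Type*} [NormedAddCommGroup E] [InnerProductSpace ℝ E]
    [FiniteDimensional ℝ E] {p ε : ℝ} (hp : 1 < p) (hε : 0 < ε) :
    ∃ C : ℝ, 0 ≤ C ∧ ∀ a b : E, ‖a - b‖ ^ p ≤ ε * (‖a‖ ^ p + ‖b‖ ^ p) +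
      C * ((‖a‖ ^ p + ‖b‖ ^ p) / 2 - ‖(1 / 2 : ℝ) • (a + b)‖ ^ p) := by
  have hp0 : 0 < p := by linarith
  set D : E × E → ℝ := fun w =>
    (‖w.1‖ ^ p + ‖w.2‖ ^ p) / 2 - ‖(1 / 2 : ℝ) • (w.1 + w.2)‖ ^ p with hD
  have hrp : Continuous fun x : ℝ => x ^ p := Real.continuous_rpow_const hp0.le
  have hDc : Continuous D := by
    refine (((hrp.comp continuous_fst.norm).add (hrp.comp continuous_snd.norm)).div_const 2).sub ?_
    exact hrp.comp ((continuous_fst.add continuous_snd).const_smul (1 / 2 : ℝ)).norm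
  -- By homogeneity only normalized pairs matter. If their difference is small, the `ε` term
  -- suffices; the others form this compact set, on which the positive convexity deficit `D` has a
  -- positive lower bound `δ`. There `‖a - b‖ ^ p ≤ 2 ^ p`, whence the constant `2 ^ p / δ`.
  set K : Set (E × E) := {w | ‖w.1‖ ^ p + ‖w.2‖ ^ p = 1 ∧ ε ≤ ‖w.1 - w.2‖ ^ p}
  have h1 : ∀ {x y : ℝ}, 0 ≤ x → 0 ≤ y → x ^ p + y ^ p = 1 → x ≤ 1 := by
    intro x y hx hy hxy
    by_contra! h
    have := Real.one_lt_rpow h hp0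
    have := Real.rpow_nonneg hy p
    linarith
  have hK : IsCompact K := by
    refine Metric.isCompact_of_isClosed_isBounded ?_ ?_
    · refine IsClosed.and ?_ ?_
      · refine isClosed_eq ?_ continuous_const
        exact (hrp.comp continuous_fst.norm).add (hrp.comp continuous_snd.norm)
      · exact isClosed_le continuous_const (hrp.comp (continuous_fst.sub continuous_snd).norm)
    · refine (Metric.isBounded_closedBall (x := (0 : E × E)) (r := 1)).subset fun w hw => ?_
      rw [mem_closedBall_zero_iff, Prod.norm_def]
      refine max_le (h1 (norm_nonneg _) (norm_nonneg _) hw.1)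
        (h1 (norm_nonneg _) (norm_nonneg w.1) ?_)
      rw [add_comm]; exact hw.1
  have hpos : ∀ w ∈ K, 0 < D w := by
    intro w hw
    have hne : w.1 ≠ w.2 := by
      intro h
      have := hw.2
      rw [h, sub_self, norm_zero, Real.zero_rpow hp0.ne'] at this
      linarith
    exact sub_pos.2 (norm_half_add_rpow_lt hp hne)
  obtain ⟨δ, hδ, hδD⟩ := hK.exists_forall_le' hDc.continuousOn hpos
  refine ⟨2 ^ p / δ, by positivity, fun a b => ?_⟩
  have hDnn : 0 ≤ D (a, b) := sub_nonneg.2 (norm_half_add_rpow_le hp a b)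
  set s := ‖a‖ ^ p + ‖b‖ ^ p with hs
  have hs0 : 0 ≤ s := by positivity
  change ‖a - b‖ ^ p ≤ ε * s + 2 ^ p / δ * D (a, b)
  rcases hs0.eq_or_lt with h0 | h0
  · have ha : ‖a‖ ^ p = 0 := by
      have := Real.rpow_nonneg (norm_nonneg a) p
      have := Real.rpow_nonneg (norm_nonneg b) p
      linarith
    have hb : ‖b‖ ^ p = 0 := by linarith
    rw [Real.rpow_eq_zero (norm_nonneg _) hp0.ne', norm_eq_zero] at ha hb
    rw [ha, hb, sub_zero, norm_zero, Real.zero_rpow hp0.ne']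
    rw [ha, hb] at hDnn
    positivity
  set l : ℝ := s ^ (-(1 / p))
  have hl : 0 < l := by positivity
  have hlp : l ^ p = s⁻¹ := by
    rw [← Real.rpow_mul hs0, neg_mul, one_div, inv_mul_cancel₀ hp0.ne', Real.rpow_neg_one]
  have hscale : ∀ c : E, ‖l • c‖ ^ p = s⁻¹ * ‖c‖ ^ p := by
    intro c
    rw [norm_smul, Real.norm_of_nonneg hl.le, Real.mul_rpow hl.le (norm_nonneg _), hlp]
  have hDs : D (l • a, l • b) = s⁻¹ * D (a, b) := by
    simp only [hD]
    rw [← smul_add, smul_comm, hscale, hscale, hscale]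
    ring
  by_cases hcase : ε ≤ ‖l • a - l • b‖ ^ p
  · have hmem : (l • a, l • b) ∈ K := by
      refine ⟨?_, hcase⟩
      simp only [hscale]
      rw [← mul_add, ← hs, inv_mul_cancel₀ h0.ne']
    have h2 := hδD _ hmem
    rw [hDs] at h2
    have h3 : ‖l • a - l • b‖ ^ p ≤ 2 ^ p := by
      have ha := h1 (norm_nonneg _) (norm_nonneg _) hmem.1
      have hb := h1 (norm_nonneg _) (norm_nonneg _) ((add_comm _ _).trans hmem.1)
      simp only at ha hb
      refine Real.rpow_le_rpow (norm_nonneg _) ?_ hp0.le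
      linarith [norm_sub_le (l • a) (l • b)]
    rw [← smul_sub, hscale, inv_mul_le_iff₀ h0] at h3
    rw [le_inv_mul_iff₀ h0] at h2
    have h4 : s * 2 ^ p ≤ 2 ^ p / δ * D (a, b) := by
      rw [div_mul_eq_mul_div, le_div_iff₀ hδ]
      nlinarith [Real.rpow_pos_of_pos (two_pos : (0 : ℝ) < 2) p]
    nlinarith
  · rw [not_le, ← smul_sub, hscale, inv_mul_lt_iff₀ h0] at hcase
    have : 0 ≤ 2 ^ p / δ * D (a, b) := by positivity
    linarith

theorem Lp_norm_rpow_eq_integral {α E : Type*} [MeasurableSpace α] {μ : Measure α}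
    [NormedAddCommGroup E] {p : ℝ} (hp : 0 < p) (a : Lp E (ENNReal.ofReal p) μ) :
    ‖a‖ ^ p = ∫ x, ‖a x‖ ^ p ∂μ := by
  have hp' : ENNReal.ofReal p ≠ 0 := by simpa using hp
  have h := (Lp.memLp a).eLpNorm_eq_integral_rpow_norm hp' ENNReal.ofReal_ne_top
  rw [ENNReal.toReal_ofReal hp.le] at h
  have h0 : 0 ≤ ∫ x, ‖a x‖ ^ p ∂μ := integral_nonneg fun x => by positivity
  rw [Lp.norm_def, h, ENNReal.toReal_ofReal (by positivity), ← Real.rpow_mul h0,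
    inv_mul_cancel₀ hp.ne', Real.rpow_one]

theorem integrable_norm_rpow_ofReal {α E : Type*} [MeasurableSpace α] {μ : Measure α}
    [NormedAddCommGroup E] {p : ℝ} (hp : 0 < p) {a : α → E} (ha : MemLp a (ENNReal.ofReal p) μ) :
    Integrable (fun x => ‖a x‖ ^ p) μ := by
  have := ha.integrable_norm_rpow (by simpa using hp) ENNReal.ofReal_ne_top
  rwa [ENNReal.toReal_ofReal hp.le] at this

/-- Uniform convexity of `L^p`. -/
theorem Lp_exists_norm_sub_lt {α E : Type*} [MeasurableSpace α] {μ : Measure α}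
    [NormedAddCommGroup E] [InnerProductSpace ℝ E] [FiniteDimensional ℝ E] {p : ℝ} (hp : 1 < p)
    (S : ℝ) {η : ℝ} (hη : 0 < η) :
    ∃ δ > 0, ∀ a b : Lp E (ENNReal.ofReal p) μ, ‖a‖ ^ p ≤ S → ‖b‖ ^ p ≤ S →
      (‖a‖ ^ p + ‖b‖ ^ p) / 2 - ‖(1 / 2 : ℝ) • (a + b)‖ ^ p < δ → ‖a - b‖ < η := by
  have hp0 : 0 < p := by linarith
  have hηp : 0 < η ^ p := by positivity
  -- Half of `η ^ p` is allotted to the `ε` term and half to the deficit, which fixes first `ε`,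
  -- then `C`, then `δ`.
  obtain ⟨ε, hε, hεS⟩ : ∃ ε > 0, ε * (2 * S) < η ^ p / 2 := by
    refine ⟨η ^ p / 2 / (2 * |S| + 1), by positivity, ?_⟩
    rw [div_mul_eq_mul_div, div_lt_iff₀ (by positivity)]
    have := le_abs_self S
    nlinarith
  obtain ⟨C, hC, hCab⟩ := exists_norm_sub_rpow_le (E := E) hp hε
  refine ⟨η ^ p / 2 / (C + 1), by positivity, fun a b ha hb hd => ?_⟩
  have key : ‖a - b‖ ^ p ≤ ε * (‖a‖ ^ p + ‖b‖ ^ p) +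
      C * ((‖a‖ ^ p + ‖b‖ ^ p) / 2 - ‖(1 / 2 : ℝ) • (a + b)‖ ^ p) := by
    simp only [Lp_norm_rpow_eq_integral hp0]
    have ia := integrable_norm_rpow_ofReal hp0 (Lp.memLp a)
    have ib := integrable_norm_rpow_ofReal hp0 (Lp.memLp b)
    have iab := integrable_norm_rpow_ofReal hp0 (Lp.memLp ((1 / 2 : ℝ) • (a + b)))
    have i1 : Integrable (fun x => ‖a x‖ ^ p + ‖b x‖ ^ p) μ := ia.add ib
    have i2 : Integrable (fun x => (‖a x‖ ^ p + ‖b x‖ ^ p) / 2 - ‖((1 / 2 : ℝ) • (a + b)) x‖ ^ p) μ :=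
      (i1.div_const 2).sub iab
    rw [← integral_add ia ib, ← integral_div, ← integral_sub (i1.div_const 2) iab,
      ← integral_const_mul, ← integral_const_mul, ← integral_add (i1.const_mul ε) (i2.const_mul C)]
    refine integral_mono_ae (integrable_norm_rpow_ofReal hp0 (Lp.memLp (a - b)))
      ((i1.const_mul ε).add (i2.const_mul C)) ?_
    filter_upwards [Lp.coeFn_sub a b, Lp.coeFn_add a b, Lp.coeFn_smul (1 / 2 : ℝ) (a + b)]
      with x h1 h2 h3
    rw [h1, h3, Pi.smul_apply, h2]
    exact hCab (a x) (b x)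
  by_contra! hcon
  have h1 : η ^ p ≤ ‖a - b‖ ^ p := Real.rpow_le_rpow hη.le hcon hp0.le
  rw [lt_div_iff₀ (by positivity)] at hd
  have : Fact (1 ≤ ENNReal.ofReal p) := ⟨by simpa using hp.le⟩
  have h2 := norm_half_add_rpow_le hp a b
  have h3 : ε * (‖a‖ ^ p + ‖b‖ ^ p) ≤ ε * (2 * S) := by gcongr; linarith
  rw [← sub_nonneg] at h2
  generalize (‖a‖ ^ p + ‖b‖ ^ p) / 2 - ‖(1 / 2 : ℝ) • (a + b)‖ ^ p = d at *
  nlinarith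

/-! ### The direct method -/

theorem exists_mul_le_mul_rpow_add {p c : ℝ} (hp : 1 < p) (hc : 0 < c) {A : ℝ} (hA : 0 ≤ A) :
    ∃ B, ∀ x, 0 ≤ x → A * x ≤ c * x ^ p + B := by
  have hp1 : 0 < p - 1 := by linarith
  -- The threshold `(A / c) ^ (1 / (p - 1))` solves `c * x ^ (p - 1) = A`: beyond it the power
  -- dominates, below it `B` does.
  refine ⟨A * (A / c) ^ (1 / (p - 1)), fun x hx => ?_⟩
  rcases le_total x ((A / c) ^ (1 / (p - 1))) with h | h
  · have h1 : A * x ≤ A * (A / c) ^ (1 / (p - 1)) := by gcongr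
    have : 0 ≤ c * x ^ p := by positivity
    linarith
  · have h1 : A / c ≤ x ^ (p - 1) := by
      have h2 := Real.rpow_le_rpow (by positivity) h hp1.le
      rwa [← Real.rpow_mul (by positivity), one_div, inv_mul_cancel₀ hp1.ne', Real.rpow_one] at h2
    have h2 : A ≤ c * x ^ (p - 1) := by rwa [div_le_iff₀' hc] at h1
    have h3 : x ^ p = x ^ (p - 1) * x := by
      rcases hx.eq_or_lt with h0 | h0
      · rw [← h0, Real.zero_rpow (by linarith), mul_zero]
      · rw [← Real.rpow_add_one h0.ne']; ring_nf
    have h4 : A * x ≤ c * x ^ p := by rw [h3, ← mul_assoc]; gcongr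
    have : 0 ≤ A * (A / c) ^ (1 / (p - 1)) := by positivity
    linarith

/-- The direct method for `w ↦ (‖w.2‖ ^ p + τ * ‖w.1‖ ^ p) / p - L w.1` on a closed subspace of a
product of two Banach spaces with uniformly convex `p`-th power of the norm. -/
theorem exists_forall_energy_le {X Y : Type*} [NormedAddCommGroup X] [NormedSpace ℝ X]
    [NormedAddCommGroup Y] [NormedSpace ℝ Y] [CompleteSpace X] [CompleteSpace Y] {p τ : ℝ}
    (hp : 1 < p) (hτ : 0 < τ)
    (hX : ∀ S η : ℝ, 0 < η → ∃ δ > 0, ∀ a b : X, ‖a‖ ^ p ≤ S → ‖b‖ ^ p ≤ S →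
      (‖a‖ ^ p + ‖b‖ ^ p) / 2 - ‖(1 / 2 : ℝ) • (a + b)‖ ^ p < δ → ‖a - b‖ < η)
    (hY : ∀ S η : ℝ, 0 < η → ∃ δ > 0, ∀ a b : Y, ‖a‖ ^ p ≤ S → ‖b‖ ^ p ≤ S →
      (‖a‖ ^ p + ‖b‖ ^ p) / 2 - ‖(1 / 2 : ℝ) • (a + b)‖ ^ p < δ → ‖a - b‖ < η)
    (W : Submodule ℝ (X × Y)) (hW : IsClosed (W : Set (X × Y))) (L : X →L[ℝ] ℝ) :
    ∃ w ∈ W, ∀ w' ∈ W, (‖w.2‖ ^ p + τ * ‖w.1‖ ^ p) / p - L w.1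
      ≤ (‖w'.2‖ ^ p + τ * ‖w'.1‖ ^ p) / p - L w'.1 := by
  have hp0 : 0 < p := by linarith
  set J : X × Y → ℝ := fun w => (‖w.2‖ ^ p + τ * ‖w.1‖ ^ p) / p - L w.1 with hJ
  have hrp : Continuous fun x : ℝ => x ^ p := Real.continuous_rpow_const hp0.le
  have hJc : Continuous J := 
    (((hrp.comp continuous_snd.norm).add ((hrp.comp continuous_fst.norm).const_mul τ)).div_const
      p).sub (L.continuous.comp continuous_fst)
  -- Half of the `τ` term absorbs the linear functional, the other half keeps the energy coercive in
  -- `w.1`.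
  obtain ⟨B, hB⟩ := exists_mul_le_mul_rpow_add hp (show 0 < τ / (2 * p) by positivity)
    (norm_nonneg L)
  have hcoer : ∀ w, ‖w.2‖ ^ p / p + τ / (2 * p) * ‖w.1‖ ^ p - B ≤ J w := by
    intro w
    have h1 : L w.1 ≤ ‖L‖ * ‖w.1‖ := (Real.le_norm_self _).trans (L.le_opNorm _)
    have h2 := hB ‖w.1‖ (norm_nonneg _)
    have h3 : (‖w.2‖ ^ p + τ * ‖w.1‖ ^ p) / p
        = ‖w.2‖ ^ p / p + τ / (2 * p) * ‖w.1‖ ^ p + τ / (2 * p) * ‖w.1‖ ^ p := by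
      field_simp; ring
    simp only [hJ]
    linarith
  have hbdd : BddBelow (J '' W) := by
    refine ⟨-B, ?_⟩
    rintro _ ⟨w, _, rfl⟩
    have : 0 ≤ ‖w.2‖ ^ p / p + τ / (2 * p) * ‖w.1‖ ^ p := by positivity
    linarith [hcoer w]
  have hne : (J '' W).Nonempty := ⟨J 0, 0, W.zero_mem, rfl⟩
  set m := sInf (J '' W)
  have hmle : ∀ w ∈ W, m ≤ J w := fun w hw => csInf_le hbdd ⟨w, hw, rfl⟩
  have hseq : ∀ n : ℕ, ∃ w ∈ W, J w < m + 1 / ((n : ℝ) + 1) := by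
    intro n
    obtain ⟨_, ⟨w, hw, rfl⟩, h⟩ := exists_lt_of_csInf_lt hne
      (show m < m + 1 / ((n : ℝ) + 1) by linarith [Nat.one_div_pos_of_nat (α := ℝ) (n := n)])
    exact ⟨w, hw, h⟩
  choose w hwW hwJ using hseq
  have hle1 : ∀ n : ℕ, 1 / ((n : ℝ) + 1) ≤ 1 := fun n => by
    rw [div_le_one (by positivity)]; linarith [(Nat.cast_nonneg n : (0 : ℝ) ≤ n)]
  have hbY : ∀ n, ‖(w n).2‖ ^ p ≤ (m + 1 + B) * p := by
    intro n
    have h1 := hcoer (w n)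
    have h2 : 0 ≤ τ / (2 * p) * ‖(w n).1‖ ^ p := by positivity
    rw [← div_le_iff₀ hp0]
    linarith [hwJ n, hle1 n]
  have hbX : ∀ n, ‖(w n).1‖ ^ p ≤ (m + 1 + B) / (τ / (2 * p)) := by
    intro n
    have h1 := hcoer (w n)
    have h2 : 0 ≤ ‖(w n).2‖ ^ p / p := by positivity
    rw [le_div_iff₀' (by positivity)]
    linarith [hwJ n, hle1 n]
  -- The midpoint lies in `W` and so has energy at least `m`; as `L` is linear, the total convexity
  -- deficit of two almost-minimizers is small. Both deficits are nonnegative, so each is small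
  -- separately, and uniform convexity gives the Cauchy property.
  have hdef : ∀ n k : ℕ, ∀ e : ℝ, 1 / ((n : ℝ) + 1) ≤ e → 1 / ((k : ℝ) + 1) ≤ e →
      ((‖(w n).2‖ ^ p + ‖(w k).2‖ ^ p) / 2 - ‖(1 / 2 : ℝ) • ((w n).2 + (w k).2)‖ ^ p) +
      τ * ((‖(w n).1‖ ^ p + ‖(w k).1‖ ^ p) / 2 - ‖(1 / 2 : ℝ) • ((w n).1 + (w k).1)‖ ^ p)
        < e * p := by
    intro n k e hn hk
    have hmid := hmle _ (W.smul_mem (1 / 2 : ℝ) (W.add_mem (hwW n) (hwW k)))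
    have h1 := hwJ n
    have h2 := hwJ k
    simp only [hJ, Prod.smul_fst, Prod.smul_snd, Prod.fst_add, Prod.snd_add] at hmid h1 h2
    have hL : L ((1 / 2 : ℝ) • ((w n).1 + (w k).1)) = (L (w n).1 + L (w k).1) / 2 := by
      rw [map_smul, map_add, smul_eq_mul]; ring
    rw [hL, ← sub_nonneg] at hmid
    rw [← div_lt_iff₀ hp0]
    have : ∀ a b c d e f : ℝ, ((a + b) / 2 - c + τ * ((d + e) / 2 - f)) / p
        = ((a + τ * d) / p + (b + τ * e) / p) / 2 - (c + τ * f) / p := by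
      intros; ring
    rw [this]
    linarith
  have hcauchy : CauchySeq w := by
    rw [Metric.cauchySeq_iff']
    intro η hη
    obtain ⟨δ₁, hδ₁, h₁⟩ := hX ((m + 1 + B) / (τ / (2 * p))) η hη
    obtain ⟨δ₂, hδ₂, h₂⟩ := hY ((m + 1 + B) * p) η hη
    obtain ⟨n₀, hn₀⟩ := exists_nat_one_div_lt
      (show 0 < min (τ * δ₁ / p) (δ₂ / p) from lt_min (by positivity) (by positivity))
    refine ⟨n₀, fun n hn => ?_⟩
    have hnn : 1 / ((n : ℝ) + 1) ≤ 1 / ((n₀ : ℝ) + 1) := Nat.one_div_le_one_div hn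
    have hd := hdef n n₀ _ hnn le_rfl
    have hdX := sub_nonneg.2 (norm_half_add_rpow_le hp (w n).1 (w n₀).1)
    have hdY := sub_nonneg.2 (norm_half_add_rpow_le hp (w n).2 (w n₀).2)
    rw [lt_min_iff, lt_div_iff₀ hp0, lt_div_iff₀ hp0] at hn₀
    rw [dist_eq_norm, Prod.norm_def]
    refine max_lt (h₁ _ _ (hbX n) (hbX n₀) ?_) (h₂ _ _ (hbY n) (hbY n₀) ?_)
    · refine lt_of_mul_lt_mul_left ?_ hτ.le
      linarith [hn₀.1]
    · have := mul_nonneg hτ.le hdX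
      linarith [hn₀.2]
  obtain ⟨w₀, hw₀⟩ := cauchySeq_tendsto_of_complete hcauchy
  refine ⟨w₀, hW.mem_of_tendsto hw₀ (Eventually.of_forall hwW), fun w' hw' => ?_⟩
  refine le_trans ?_ (hmle w' hw')
  have hlim : Tendsto (fun n : ℕ => m + 1 / ((n : ℝ) + 1)) atTop (𝓝 (m + 0)) :=
    tendsto_const_nhds.add tendsto_one_div_add_atTop_nhds_zero_nat
  rw [add_zero] at hlim
  exact le_of_tendsto_of_tendsto' ((hJc.tendsto w₀).comp hw₀) hlim fun n => (hwJ n).le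

/-! ### Differentiability of the energy -/

/-- For `p < 2` the power is singular at `a = 0`; the inner product compensates, leaving the
exponent `p - 1 > 0` in the uses below. -/
theorem abs_rpow_mul_inner_le {E : Type*} [NormedAddCommGroup E] [InnerProductSpace ℝ E] (p : ℝ)
    (a b : E) : |‖a‖ ^ (p - 2) * inner ℝ a b| ≤ ‖a‖ ^ (p - 1) * ‖b‖ := by
  rcases (norm_nonneg a).eq_or_lt with h | h
  · have : a = 0 := norm_eq_zero.1 h.symm
    simp only [this, inner_zero_left, mul_zero, abs_zero]
    positivity
  · rw [abs_mul, abs_of_nonneg (by positivity)]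
    calc ‖a‖ ^ (p - 2) * |inner ℝ a b| ≤ ‖a‖ ^ (p - 2) * (‖a‖ * ‖b‖) := by
          gcongr; exact abs_real_inner_le_norm a b
      _ = _ := by
          rw [← mul_assoc, ← Real.rpow_add_one h.ne']; ring_nf

theorem rpow_sub_one_mul_le {p x y : ℝ} (hp : 1 < p) (hx : 0 ≤ x) (hy : 0 ≤ y) :
    x ^ (p - 1) * y ≤ (x + y) ^ p := by
  rcases (add_nonneg hx hy).eq_or_lt with h | h
  · have hy0 : y = 0 := by linarith
    rw [hy0, mul_zero]; positivity
  · calc x ^ (p - 1) * y ≤ (x + y) ^ (p - 1) * (x + y) := by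
          gcongr
          · linarith
          · linarith
      _ = _ := by rw [← Real.rpow_add_one h.ne']; ring_nf

theorem hasDerivAt_integral_norm_rpow {α E : Type*} [MeasurableSpace α] {μ : Measure α}
    [NormedAddCommGroup E] [InnerProductSpace ℝ E] {p : ℝ} (hp : 1 < p) {a b : α → E}
    (ha : MemLp a (ENNReal.ofReal p) μ) (hb : MemLp b (ENNReal.ofReal p) μ) :
    HasDerivAt (fun t : ℝ => ∫ x, ‖a x + t • b x‖ ^ p ∂μ)
      (p * ∫ x, ‖a x‖ ^ (p - 2) * inner ℝ (a x) (b x) ∂μ) 0 := by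
  have hp0 : 0 < p := by linarith
  -- Dominates the derivative for `|t| < 1`, since then `‖a + t • b‖ + ‖b‖ ≤ 2 * (‖a‖ + ‖b‖)`.
  have hint : Integrable (fun x => p * (2 * (‖a x‖ + ‖b x‖)) ^ p) μ := by
    have := integrable_norm_rpow_ofReal hp0 ((ha.norm.add hb.norm).const_mul 2)
    refine (this.const_mul p).congr (Eventually.of_forall fun x => ?_)
    simp only [Pi.add_apply, Real.norm_eq_abs]
    rw [abs_of_nonneg (by positivity)]
  have hr : Continuous (fun y : E => ‖y‖ ^ p) := continuous_norm.rpow_const fun _ => Or.inr hp0.le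
  have hm : ∀ t : ℝ, AEStronglyMeasurable (fun x => a x + t • b x) μ := fun t =>
    ha.aestronglyMeasurable.add (hb.aestronglyMeasurable.const_smul t)
  have key := (hasDerivAt_integral_of_dominated_loc_of_deriv_le (μ := μ) (x₀ := (0 : ℝ))
    (F := fun (t : ℝ) x => ‖a x + t • b x‖ ^ p)
    (F' := fun (t : ℝ) x => p * (‖a x + t • b x‖ ^ (p - 2) * inner ℝ (a x + t • b x) (b x)))
    (bound := fun x => p * (2 * (‖a x‖ + ‖b x‖)) ^ p)
    (Metric.ball_mem_nhds (0 : ℝ) one_pos)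
    (Eventually.of_forall fun t => hr.comp_aestronglyMeasurable (hm t)) ?_ ?_
    (Eventually.of_forall fun x t ht => ?_) hint (Eventually.of_forall fun x t ht => ?_)).2
  · simpa [integral_const_mul] using key
  · simpa using integrable_norm_rpow_ofReal hp0 ha
  · refine AEStronglyMeasurable.const_mul ?_ p
    simp only [zero_smul, add_zero]
    exact (ha.aestronglyMeasurable.norm.aemeasurable.pow_const _).aestronglyMeasurable.mul
      (ha.aestronglyMeasurable.inner hb.aestronglyMeasurable)
  · have ht1 : ‖t‖ ≤ 1 := by
      rw [mem_ball_zero_iff] at ht; exact ht.le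
    rw [Real.norm_eq_abs, abs_mul, abs_of_pos hp0]
    gcongr
    refine (abs_rpow_mul_inner_le p _ _).trans ((rpow_sub_one_mul_le hp (norm_nonneg _)
      (norm_nonneg _)).trans ?_)
    have h1 : ‖a x + t • b x‖ ≤ ‖a x‖ + ‖b x‖ := by
      refine (norm_add_le _ _).trans ?_
      rw [norm_smul]
      have := mul_le_mul_of_nonneg_right ht1 (norm_nonneg (b x))
      linarith
    gcongr
    linarith [norm_nonneg (a x)]
  · have h1 : HasDerivAt (fun t : ℝ => a x + t • b x) (b x) t := by
      simpa using ((hasDerivAt_id t).smul_const (b x)).const_add (a x)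
    have h2 := (hasFDerivAt_norm_rpow (a x + t • b x) hp).comp_hasDerivAt t h1
    refine h2.congr_deriv ?_
    simp only [smul_apply, innerSL_apply_apply, smul_eq_mul, mul_assoc]

theorem exists_Lp_inner_functional {α E : Type*} [MeasurableSpace α] {μ : Measure α}
    [NormedAddCommGroup E] [InnerProductSpace ℝ E] [CompleteSpace E] {P Q : ℝ≥0∞} [Fact (1 ≤ P)]
    [Fact (1 ≤ Q)] [P.HolderConjugate Q] {g : α → E} (hg : MemLp g Q μ) :
    ∃ L : Lp E P μ →L[ℝ] ℝ, ∀ a, L a = ∫ x, inner ℝ (a x) (g x) ∂μ := by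
  refine ⟨((innerSL ℝ : E →L[ℝ] E →L[ℝ] ℝ).lpPairing μ P Q).flip (hg.toLp g), fun a => ?_⟩
  rw [ContinuousLinearMap.flip_apply, ContinuousLinearMap.lpPairing_eq_integral]
  refine integral_congr_ae ?_
  filter_upwards [hg.coeFn_toLp] with x hx
  rw [innerSL_apply_apply, hx]

/-! ### The Sobolev space and existence of a weak solution -/

section Sobolev

variable {N : ℕ} {p : ℝ} {Ω : Set (RN N)}

theorem IsSobolevWithGradient.integrableOn {u : RN N → ℝ} {G : RN N → RN N} (hp : 1 ≤ p)
    (hΩ : volume Ω ≠ ⊤) (h : IsSobolevWithGradient p Ω u G) : IntegrableOn u Ω := by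
  have : IsFiniteMeasure (volume.restrict Ω) := ⟨by simpa using hΩ.lt_top⟩
  exact h.memLp.integrable (by simpa using hp)

theorem IsSobolevWithGradient.integrableOn_grad {u : RN N → ℝ} {G : RN N → RN N} (hp : 1 ≤ p)
    (hΩ : volume Ω ≠ ⊤) (h : IsSobolevWithGradient p Ω u G) : IntegrableOn G Ω := by
  have : IsFiniteMeasure (volume.restrict Ω) := ⟨by simpa using hΩ.lt_top⟩
  exact h.memLp_grad.integrable (by simpa using hp)

/-- On a set of finite measure `L^p` embeds into `L^1`, so the local integrability conditions are
automatic. -/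
theorem IsSobolevWithGradient.of_integral_eq {u : RN N → ℝ} {G : RN N → RN N} (hp : 1 ≤ p)
    (hΩ : volume Ω ≠ ⊤) (hu : MemLp u (ENNReal.ofReal p) (volume.restrict Ω))
    (hG : MemLp G (ENNReal.ofReal p) (volume.restrict Ω))
    (h : ∀ φ : RN N → ℝ, ContDiff ℝ ∞ φ → HasCompactSupport φ → tsupport φ ⊆ Ω →
      ∀ v : RN N, ∫ x in Ω, u x * fderiv ℝ φ x v = - ∫ x in Ω, φ x * inner ℝ (G x) v) :
    IsSobolevWithGradient p Ω u G := by
  have : IsFiniteMeasure (volume.restrict Ω) := ⟨by simpa using hΩ.lt_top⟩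
  have hu1 : IntegrableOn u Ω := hu.integrable (by simpa using hp)
  have hG1 : IntegrableOn G Ω := hG.integrable (by simpa using hp)
  exact ⟨hu, hG, hu1.locallyIntegrableOn, hG1.locallyIntegrableOn, h⟩

theorem IsSobolevWithGradient.congr {u u' : RN N → ℝ} {G G' : RN N → RN N} (hp : 1 ≤ p)
    (hΩ : volume Ω ≠ ⊤) (h : IsSobolevWithGradient p Ω u G) (hu : u =ᵐ[volume.restrict Ω] u')
    (hG : G =ᵐ[volume.restrict Ω] G') : IsSobolevWithGradient p Ω u' G' := by
  refine .of_integral_eq hp hΩ (h.memLp.ae_eq hu) (h.memLp_grad.ae_eq hG) ?_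
  intro φ h1 h2 h3 v
  have e1 : ∫ x in Ω, u' x * fderiv ℝ φ x v = ∫ x in Ω, u x * fderiv ℝ φ x v :=
    integral_congr_ae (hu.mono fun x hx => by simp only [hx])
  have e2 : ∫ x in Ω, φ x * inner ℝ (G' x) v = ∫ x in Ω, φ x * inner ℝ (G x) v :=
    integral_congr_ae (hG.mono fun x hx => by simp only [hx])
  rw [e1, e2]
  exact h.isWeakGradient.integral_eq φ h1 h2 h3 v

theorem memLp_test {φ : RN N → ℝ} (h1 : ContDiff ℝ ∞ φ) (h2 : HasCompactSupport φ) (v : RN N)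
    (q : ℝ≥0∞) (μ : Measure (RN N)) [IsFiniteMeasureOnCompacts μ] :
    MemLp φ q μ ∧ MemLp (fun x => fderiv ℝ φ x v) q μ := 
  ⟨h1.continuous.memLp_of_hasCompactSupport h2,
    ((h1.continuous_fderiv (by simp)).clm_apply continuous_const).memLp_of_hasCompactSupport
      (h2.fderiv_apply ℝ v)⟩

/-- The Sobolev space `W^{1,p}(Ω)` as a closed subspace of `L^p(Ω) × L^p(Ω; ℝ^N)`. -/
theorem exists_sobolev_submodule (hp : 1 < p) (hΩ : volume Ω ≠ ⊤)
    [Fact (1 ≤ ENNReal.ofReal p)] :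
    ∃ W : Submodule ℝ (Lp ℝ (ENNReal.ofReal p) (volume.restrict Ω) ×
        Lp (RN N) (ENNReal.ofReal p) (volume.restrict Ω)),
      IsClosed (W : Set (Lp ℝ (ENNReal.ofReal p) (volume.restrict Ω) ×
        Lp (RN N) (ENNReal.ofReal p) (volume.restrict Ω))) ∧
      ∀ w, w ∈ W ↔ IsSobolevWithGradient p Ω w.1 w.2 := by
  have hfin : IsFiniteMeasure (volume.restrict Ω) := ⟨by simpa using hΩ.lt_top⟩
  have hpq : p.HolderConjugate (p / (p - 1)) := Real.HolderConjugate.conjExponent hp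
  have hPQ := hpq.ennrealOfReal
  have hQ : Fact (1 ≤ ENNReal.ofReal (p / (p - 1))) := ⟨by simpa using hpq.symm.lt.le⟩
  let ι := {φ : RN N → ℝ // ContDiff ℝ ∞ φ ∧ HasCompactSupport φ ∧ tsupport φ ⊆ Ω} × RN N
  -- Each test function and direction defines a continuous functional, because the test functions
  -- lie in the conjugate `L^{p/(p-1)}`; the Sobolev space is the intersection of the kernels, hence
  -- closed.
  have hT : ∀ i : ι, ∃ T : (Lp ℝ (ENNReal.ofReal p) (volume.restrict Ω) ×
        Lp (RN N) (ENNReal.ofReal p) (volume.restrict Ω)) →L[ℝ] ℝ, ∀ w, T w =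
      (∫ x in Ω, w.1 x * fderiv ℝ i.1.1 x i.2) + ∫ x in Ω, i.1.1 x * inner ℝ (w.2 x) i.2 := by
    rintro ⟨⟨φ, h1, h2, h3⟩, v⟩
    obtain ⟨hm1, hm2⟩ := memLp_test h1 h2 v (ENNReal.ofReal (p / (p - 1))) (volume.restrict Ω)
    have hm3 : MemLp (fun x => φ x • v) (ENNReal.ofReal (p / (p - 1))) (volume.restrict Ω) :=
      (h1.continuous.smul continuous_const).memLp_of_hasCompactSupport h2.smul_right
    obtain ⟨L₁, hL₁⟩ := exists_Lp_inner_functional (P := ENNReal.ofReal p) hm2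
    obtain ⟨L₂, hL₂⟩ := exists_Lp_inner_functional (P := ENNReal.ofReal p) hm3
    refine ⟨L₁.comp (ContinuousLinearMap.fst ℝ _ _) + L₂.comp (ContinuousLinearMap.snd ℝ _ _),
      fun w => ?_⟩
    simp only [_root_.add_apply, ContinuousLinearMap.comp_apply,
      ContinuousLinearMap.coe_fst', ContinuousLinearMap.coe_snd', hL₁, hL₂, inner_smul_right]
    congr 2
    ext x
    simp [mul_comm]
  choose T hT using hT
  refine ⟨⨅ i, LinearMap.ker (T i : _ →ₗ[ℝ] ℝ), ?_, fun w => ?_⟩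
  · rw [Submodule.coe_iInf]
    exact isClosed_iInter fun i => (T i).isClosed_ker
  · rw [Submodule.mem_iInf]
    constructor
    · intro h
      refine .of_integral_eq hp.le hΩ (Lp.memLp _) (Lp.memLp _) fun φ h1 h2 h3 v => ?_
      have := h (⟨φ, h1, h2, h3⟩, v)
      rw [LinearMap.mem_ker, ContinuousLinearMap.coe_coe, hT] at this
      linarith
    · intro h i
      rw [LinearMap.mem_ker, ContinuousLinearMap.coe_coe, hT,
        h.isWeakGradient.integral_eq _ i.1.2.1 i.1.2.2.1 i.1.2.2.2]
      ring

theorem Lp_exists_forall_energy_le {α E : Type*} [MeasurableSpace α] {μ : Measure α}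
    [NormedAddCommGroup E] [InnerProductSpace ℝ E] [FiniteDimensional ℝ E] (hp : 1 < p)
    [Fact (1 ≤ ENNReal.ofReal p)] {τ : ℝ} (hτ : 0 < τ)
    (W : Submodule ℝ (Lp ℝ (ENNReal.ofReal p) μ × Lp E (ENNReal.ofReal p) μ))
    (hW : IsClosed (W : Set (Lp ℝ (ENNReal.ofReal p) μ × Lp E (ENNReal.ofReal p) μ)))
    (L : Lp ℝ (ENNReal.ofReal p) μ →L[ℝ] ℝ) :
    ∃ w ∈ W, ∀ w' ∈ W, (‖w.2‖ ^ p + τ * ‖w.1‖ ^ p) / p - L w.1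
      ≤ (‖w'.2‖ ^ p + τ * ‖w'.1‖ ^ p) / p - L w'.1 := by
  have : CompleteSpace E := FiniteDimensional.complete ℝ E
  have hX : ∀ S η : ℝ, 0 < η → ∃ δ > 0, ∀ a b : Lp ℝ (ENNReal.ofReal p) μ, ‖a‖ ^ p ≤ S →
      ‖b‖ ^ p ≤ S → (‖a‖ ^ p + ‖b‖ ^ p) / 2 - ‖(1 / 2 : ℝ) • (a + b)‖ ^ p < δ → ‖a - b‖ < η :=
    fun S _ hη => Lp_exists_norm_sub_lt hp S hη
  have hY : ∀ S η : ℝ, 0 < η → ∃ δ > 0, ∀ a b : Lp E (ENNReal.ofReal p) μ, ‖a‖ ^ p ≤ S →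
      ‖b‖ ^ p ≤ S → (‖a‖ ^ p + ‖b‖ ^ p) / 2 - ‖(1 / 2 : ℝ) • (a + b)‖ ^ p < δ → ‖a - b‖ < η :=
    fun S _ hη => Lp_exists_norm_sub_lt hp S hη
  exact exists_forall_energy_le hp hτ hX hY W hW L

/-- The energy of the Neumann problem has a minimizer in `W^{1,p}(Ω)`. -/
theorem exists_sobolev_minimizer (hp : 1 < p) {τ : ℝ} (hτ : 0 < τ) (hΩ : volume Ω ≠ ⊤)
    {f : RN N → ℝ} (hf : MemLp f (ENNReal.ofReal (p / (p - 1))) (volume.restrict Ω)) :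
    ∃ u G, IsSobolevWithGradient p Ω u G ∧ ∀ u' G', IsSobolevWithGradient p Ω u' G' →
      ((∫ x in Ω, ‖G x‖ ^ p) + τ * ∫ x in Ω, ‖u x‖ ^ p) / p - ∫ x in Ω, f x * u x ≤
      ((∫ x in Ω, ‖G' x‖ ^ p) + τ * ∫ x in Ω, ‖u' x‖ ^ p) / p - ∫ x in Ω, f x * u' x := by
  have hp0 : 0 < p := by linarith
  have hP : Fact (1 ≤ ENNReal.ofReal p) := ⟨by simpa using hp.le⟩
  have hpq : p.HolderConjugate (p / (p - 1)) := Real.HolderConjugate.conjExponent hp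
  have hPQ := hpq.ennrealOfReal
  have hQ : Fact (1 ≤ ENNReal.ofReal (p / (p - 1))) := ⟨by simpa using hpq.symm.lt.le⟩
  obtain ⟨W, hW, hWS⟩ := exists_sobolev_submodule (N := N) hp hΩ
  obtain ⟨L, hL⟩ := exists_Lp_inner_functional (P := ENNReal.ofReal p) hf
  obtain ⟨w, hwW, hmin⟩ := Lp_exists_forall_energy_le hp hτ W hW L
  refine ⟨w.1, w.2, (hWS w).1 hwW, fun u' G' h => ?_⟩
  have hLi : ∀ a : Lp ℝ (ENNReal.ofReal p) (volume.restrict Ω), L a = ∫ x in Ω, f x * a x := by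
    intro a
    rw [hL]
    congr 1
  have hmem := (hWS (h.memLp.toLp u', h.memLp_grad.toLp G')).2 (h.congr hp.le hΩ
    h.memLp.coeFn_toLp.symm h.memLp_grad.coeFn_toLp.symm)
  have key := hmin _ hmem
  rw [Lp_norm_rpow_eq_integral hp0, Lp_norm_rpow_eq_integral hp0, hLi] at key
  refine key.trans (le_of_eq ?_)
  have e1 : ∫ x in Ω, ‖h.memLp.toLp u' x‖ ^ p = ∫ x in Ω, ‖u' x‖ ^ p :=
    integral_congr_ae (h.memLp.coeFn_toLp.mono fun x hx => by simp only [hx])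
  have e2 : ∫ x in Ω, ‖h.memLp_grad.toLp G' x‖ ^ p = ∫ x in Ω, ‖G' x‖ ^ p :=
    integral_congr_ae (h.memLp_grad.coeFn_toLp.mono fun x hx => by simp only [hx])
  have e3 : ∫ x in Ω, f x * h.memLp.toLp u' x = ∫ x in Ω, f x * u' x :=
    integral_congr_ae (h.memLp.coeFn_toLp.mono fun x hx => by simp only [hx])
  rw [Lp_norm_rpow_eq_integral hp0, Lp_norm_rpow_eq_integral hp0, hLi, e1, e2, e3]

theorem IsSobolevWithGradient.add_smul {u ξ : RN N → ℝ} {G H : RN N → RN N} (hp : 1 ≤ p)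
    (hΩ : volume Ω ≠ ⊤) (h : IsSobolevWithGradient p Ω u G) (h' : IsSobolevWithGradient p Ω ξ H)
    (t : ℝ) : IsSobolevWithGradient p Ω (fun x => u x + t • ξ x) (fun x => G x + t • H x) := by
  have hfin : IsFiniteMeasure (volume.restrict Ω) := ⟨by simpa using hΩ.lt_top⟩
  refine .of_integral_eq hp hΩ (h.memLp.add (h'.memLp.const_smul t))
    (h.memLp_grad.add (h'.memLp_grad.const_smul t)) fun φ h1 h2 h3 v => ?_
  obtain ⟨⟨hm1, C1, hC1⟩, hm2, C2, hC2⟩ : (AEStronglyMeasurable φ (volume.restrict Ω) ∧ ∃ C, ∀ x,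
      ‖φ x‖ ≤ C) ∧ AEStronglyMeasurable (fun x => fderiv ℝ φ x v) (volume.restrict Ω) ∧
      ∃ C, ∀ x, ‖fderiv ℝ φ x v‖ ≤ C := by
    have hc := (h1.continuous_fderiv (by simp)).clm_apply (continuous_const (y := v))
    exact ⟨⟨h1.continuous.aestronglyMeasurable,
      h1.continuous.bounded_above_of_compact_support h2⟩, hc.aestronglyMeasurable,
      hc.bounded_above_of_compact_support (h2.fderiv_apply ℝ v)⟩
  have i1 := (h.integrableOn hp hΩ).mul_bdd hm2 (Eventually.of_forall hC2)
  have i2 := (h'.integrableOn hp hΩ).mul_bdd hm2 (Eventually.of_forall hC2)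
  have i3 := ((h.integrableOn_grad hp hΩ).inner_const v).bdd_mul hm1 (Eventually.of_forall hC1)
  have i4 := ((h'.integrableOn_grad hp hΩ).inner_const v).bdd_mul hm1 (Eventually.of_forall hC1)
  have e1 : ∀ x, (u x + t • ξ x) * fderiv ℝ φ x v
      = u x * fderiv ℝ φ x v + t * (ξ x * fderiv ℝ φ x v) := by
    intro x; simp only [smul_eq_mul]; ring
  have e2 : ∀ x, φ x * inner ℝ (G x + t • H x) v
      = φ x * inner ℝ (G x) v + t * (φ x * inner ℝ (H x) v) := by
    intro x; rw [inner_add_left, real_inner_smul_left]; ring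
  simp_rw [e1, e2]
  rw [integral_add i1 (i2.const_mul t), integral_add i3 (i4.const_mul t), integral_const_mul,
    integral_const_mul, h.isWeakGradient.integral_eq φ h1 h2 h3 v,
    h'.isWeakGradient.integral_eq φ h1 h2 h3 v]
  ring

theorem integrable_mul_of_memLp_conj {α : Type*} [MeasurableSpace α] {μ : Measure α} (hp : 1 < p)
    {f ξ : α → ℝ} (hf : MemLp f (ENNReal.ofReal (p / (p - 1))) μ)
    (hξ : MemLp ξ (ENNReal.ofReal p) μ) : Integrable (fun x => f x * ξ x) μ := by
  have hpq : (p / (p - 1)).HolderConjugate p := (Real.HolderConjugate.conjExponent hp).symm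
  have hPQ := hpq.ennrealOfReal
  exact hf.integrable_mul hξ

/-- The weak formulation is the Euler–Lagrange equation: the energy along `u + t ξ` has a minimum at
`t = 0`, so its derivative vanishes there. -/
theorem exists_isNeumannWeakSolution (hp : 1 < p) {τ : ℝ} (hτ : 0 < τ) (hΩ : volume Ω ≠ ⊤)
    {f : RN N → ℝ} (hf : MemLp f (ENNReal.ofReal (p / (p - 1))) (volume.restrict Ω)) :
    ∃ u, IsNeumannWeakSolution p τ Ω f u := by
  have hp0 : 0 < p := by linarith
  obtain ⟨u, G, hu, hmin⟩ := exists_sobolev_minimizer (N := N) hp hτ hΩ hf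
  refine ⟨u, G, hu, fun ξ H hξ => ?_⟩
  set j : ℝ → ℝ := fun t => ((∫ x in Ω, ‖G x + t • H x‖ ^ p) +
    τ * ∫ x in Ω, ‖u x + t • ξ x‖ ^ p) / p - ((∫ x in Ω, f x * u x) + t * ∫ x in Ω, f x * ξ x)
  have hjmin : IsLocalMin j 0 := by
    refine Eventually.of_forall fun t => ?_
    have := hmin _ _ (hu.add_smul hp.le hΩ hξ t)
    have e : ∫ x in Ω, f x * (u x + t • ξ x)
        = (∫ x in Ω, f x * u x) + t * ∫ x in Ω, f x * ξ x := by
      rw [← integral_const_mul, ← integral_add (integrable_mul_of_memLp_conj hp hf hu.memLp)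
        ((integrable_mul_of_memLp_conj hp hf hξ.memLp).const_mul t)]
      congr 1; ext x
      simp only [smul_eq_mul]; ring
    rw [e] at this
    simpa [j] using this
  have hd1 := hasDerivAt_integral_norm_rpow hp hu.memLp_grad hξ.memLp_grad
  have hd2 := hasDerivAt_integral_norm_rpow hp hu.memLp hξ.memLp
  have hd3 : HasDerivAt (fun t : ℝ => (∫ x in Ω, f x * u x) + t * ∫ x in Ω, f x * ξ x)
      (∫ x in Ω, f x * ξ x) 0 := by
    simpa using ((hasDerivAt_id (0 : ℝ)).mul_const (∫ x in Ω, f x * ξ x)).const_add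
      (∫ x in Ω, f x * u x)
  have hd := ((hd1.add (hd2.const_mul τ)).div_const p).sub hd3
  have h0 := hjmin.hasDerivAt_eq_zero hd
  have e4 : ∫ x in Ω, |u x| ^ (p - 2) * u x * ξ x
      = ∫ x in Ω, ‖u x‖ ^ (p - 2) * inner ℝ (u x) (ξ x) := by
    congr 1; ext x
    simp; ring
  rw [e4]
  have h1 : ∀ A B : ℝ, (p * A + τ * (p * B)) / p = A + τ * B := by
    intro A B; field_simp
  rw [h1] at h0
  linarith

end Sobolev

/-! ### Monotonicity and uniqueness -/

/-- Strict monotonicity of the duality map `a ↦ ‖a‖ ^ (p - 2) • a`. -/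
theorem rpow_mul_inner_sub_pos {E : Type*} [NormedAddCommGroup E] [InnerProductSpace ℝ E] {p : ℝ}
    (hp : 1 < p) {a b : E} (hab : a ≠ b) :
    0 < ‖a‖ ^ (p - 2) * inner ℝ a (a - b) - ‖b‖ ^ (p - 2) * inner ℝ b (a - b) := by
  have hself : ∀ x : ℝ, 0 ≤ x → x ^ (p - 2) * x = x ^ (p - 1) := by
    intro x hx
    rcases hx.eq_or_lt with h | h
    · rw [← h, mul_zero, Real.zero_rpow (by linarith)]
    · rw [← Real.rpow_add_one h.ne']; ring_nf
  rw [inner_sub_right, inner_sub_right, real_inner_self_eq_norm_sq, real_inner_self_eq_norm_sq,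
    real_inner_comm a b]
  set x := ‖a‖
  set y := ‖b‖
  have hx : 0 ≤ x := norm_nonneg a
  have hy : 0 ≤ y := norm_nonneg b
  have hX := hself x hx
  have hY := hself y hy
  have hcs : inner ℝ a b ≤ x * y := real_inner_le_norm a b
  -- For equal norms the expression is exactly `x ^ (p - 2) * ‖a - b‖ ^ 2`. Otherwise Cauchy–Schwarz
  -- bounds it below by `(x ^ (p - 1) - y ^ (p - 1)) * (x - y)`.
  by_cases hxy : x = y
  · have hd : 0 < ‖a - b‖ ^ 2 := by
      have := norm_pos_iff.2 (sub_ne_zero.2 hab)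
      positivity
    rw [norm_sub_sq_real] at hd
    have hx0 : 0 < x := by
      rcases hx.eq_or_lt with h | h
      · exfalso
        apply hab
        rw [norm_eq_zero.1 h.symm, norm_eq_zero.1 (hxy.symm.trans h.symm)]
      · exact h
    have := mul_pos (Real.rpow_pos_of_pos hx0 (p - 2)) hd
    change 0 < x ^ (p - 2) * (x ^ 2 - 2 * inner ℝ a b + y ^ 2) at this
    rw [← hxy] at this ⊢
    linarith
  · have h1 : 0 < (x ^ (p - 1) - y ^ (p - 1)) * (x - y) := by
      rcases lt_or_gt_of_ne hxy with h | h
      · exact mul_pos_of_neg_of_neg (sub_neg.2 (Real.rpow_lt_rpow hx h (by linarith)))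
          (sub_neg.2 h)
      · exact mul_pos (sub_pos.2 (Real.rpow_lt_rpow hy h (by linarith))) (sub_pos.2 h)
    have h2 : (x ^ (p - 2) + y ^ (p - 2)) * inner ℝ a b ≤ (x ^ (p - 2) + y ^ (p - 2)) * (x * y) := by
      gcongr
    rw [← hX, ← hY] at h1
    linarith

theorem integrable_rpow_mul_inner {α E : Type*} [MeasurableSpace α] {μ : Measure α}
    [NormedAddCommGroup E] [InnerProductSpace ℝ E] {p : ℝ} (hp : 1 < p) {a b : α → E}
    (ha : MemLp a (ENNReal.ofReal p) μ) (hb : MemLp b (ENNReal.ofReal p) μ) :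
    Integrable (fun x => ‖a x‖ ^ (p - 2) * inner ℝ (a x) (b x)) μ := by
  have h := integrable_norm_rpow_ofReal (by linarith) (ha.norm.add hb.norm)
  refine h.mono' ?_ (Eventually.of_forall fun x => ?_)
  · exact (ha.aestronglyMeasurable.norm.aemeasurable.pow_const _).aestronglyMeasurable.mul
      (ha.aestronglyMeasurable.inner hb.aestronglyMeasurable)
  · rw [Real.norm_eq_abs, Pi.add_apply, Real.norm_of_nonneg (by positivity)]
    exact (abs_rpow_mul_inner_le p _ _).trans
      (rpow_sub_one_mul_le hp (norm_nonneg _) (norm_nonneg _))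

theorem rpow_mul_inner_sub_nonneg {E : Type*} [NormedAddCommGroup E] [InnerProductSpace ℝ E]
    {p : ℝ} (hp : 1 < p) (a b : E) :
    0 ≤ ‖a‖ ^ (p - 2) * inner ℝ a (a - b) - ‖b‖ ^ (p - 2) * inner ℝ b (a - b) := by
  by_cases h : a = b
  · simp [h]
  · exact (rpow_mul_inner_sub_pos hp h).le

/-- Testing both equations with `u - v` and subtracting leaves a vanishing sum of two nonnegative
integrals. As `τ > 0`, the zeroth-order one vanishes, and strict monotonicity forces `u = v`. -/
theorem IsNeumannWeakSolution.ae_eq {N : ℕ} {p τ : ℝ} {Ω : Set (RN N)} {f u v : RN N → ℝ}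
    (hp : 1 < p) (hτ : 0 < τ) (hΩ : volume Ω ≠ ⊤) (hu : IsNeumannWeakSolution p τ Ω f u)
    (hv : IsNeumannWeakSolution p τ Ω f v) : u =ᵐ[volume.restrict Ω] v := by
  obtain ⟨G, hG, hu⟩ := hu
  obtain ⟨H, hH, hv⟩ := hv
  have hd : IsSobolevWithGradient p Ω (fun x => u x - v x) (fun x => G x - H x) := by
    have := hG.add_smul hp.le hΩ hH (-1)
    simpa [← sub_eq_add_neg] using this
  have e := (hu _ _ hd).trans (hv _ _ hd).symm
  have hr : ∀ a b : ℝ, |a| ^ (p - 2) * a * b = ‖a‖ ^ (p - 2) * inner ℝ a b := by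
    intro a b; simp; ring
  simp_rw [hr] at e
  have i1 := integrable_rpow_mul_inner hp hG.memLp_grad hd.memLp_grad
  have i2 := integrable_rpow_mul_inner hp hH.memLp_grad hd.memLp_grad
  have i3 := integrable_rpow_mul_inner hp hG.memLp hd.memLp
  have i4 := integrable_rpow_mul_inner hp hH.memLp hd.memLp
  have n1 : 0 ≤ ∫ x in Ω, (‖G x‖ ^ (p - 2) * inner ℝ (G x) (G x - H x)
      - ‖H x‖ ^ (p - 2) * inner ℝ (H x) (G x - H x)) :=
    integral_nonneg fun x => rpow_mul_inner_sub_nonneg hp _ _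
  have n2 : 0 ≤ ∫ x in Ω, (‖u x‖ ^ (p - 2) * inner ℝ (u x) (u x - v x)
      - ‖v x‖ ^ (p - 2) * inner ℝ (v x) (u x - v x)) :=
    integral_nonneg fun x => rpow_mul_inner_sub_nonneg hp _ _
  have hz : ∫ x in Ω, (‖u x‖ ^ (p - 2) * inner ℝ (u x) (u x - v x)
      - ‖v x‖ ^ (p - 2) * inner ℝ (v x) (u x - v x)) = 0 := by
    refine le_antisymm ?_ n2
    refine le_of_mul_le_mul_left ?_ hτ
    rw [integral_sub i3 i4]
    rw [integral_sub i1 i2] at n1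
    linarith
  rw [integral_eq_zero_iff_of_nonneg (fun x => rpow_mul_inner_sub_nonneg hp _ _) (i3.sub i4)] at hz
  filter_upwards [hz] with x hx
  by_contra hne
  exact (rpow_mul_inner_sub_pos hp hne).ne' hx

/-! ### Truncations and the energy estimate on superlevel sets -/

/-- A `C^1` step function between `0` and `1` with slope at most one. -/
theorem exists_smooth_step : ∃ (c : ℝ) (S S' : ℝ → ℝ), 0 < c ∧ c ≤ 1 ∧
    (∀ t, HasDerivAt S (S' t) t) ∧ Continuous S' ∧ (∀ t, 0 ≤ S' t) ∧ (∀ t, S' t ≤ 1) ∧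
    (∀ t ≤ 0, S t = 0) ∧ (∀ t, 1 ≤ t → S t = c) ∧ (∀ t, 0 ≤ S t) ∧ (∀ t, S t ≤ c) ∧
    ∀ t, 0 ≤ t → S t ≤ t := by
  -- A continuous tent as derivative makes `S` of class `C^1`, as the chain rule requires; the price
  -- is the height `c = S 1` instead of `1`.
  set S' : ℝ → ℝ := fun t => max 0 (min t (1 - t)) with hS'
  have hc : Continuous S' := by fun_prop
  have h0 : ∀ t, 0 ≤ S' t := fun t => le_max_left _ _
  have h1 : ∀ t, S' t ≤ 1 := fun t => max_le zero_le_one (by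
    rcases le_total t 1 with h | h
    · exact (min_le_left _ _).trans h
    · exact (min_le_right _ _).trans (by linarith))
  have hi : ∀ a b, IntervalIntegrable S' volume a b := fun a b => hc.intervalIntegrable a b
  have hneg : ∀ t ≤ 0, S' t = 0 := fun t ht => max_eq_left ((min_le_left _ _).trans ht)
  have hbig : ∀ t, 1 ≤ t → S' t = 0 := fun t ht =>
    max_eq_left ((min_le_right _ _).trans (by linarith))
  set S : ℝ → ℝ := fun t => ∫ s in (0 : ℝ)..t, S' s with hS
  have hder : ∀ t, HasDerivAt S (S' t) t := fun t =>
    intervalIntegral.integral_hasDerivAt_right (hi 0 t)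
      hc.stronglyMeasurable.stronglyMeasurableAtFilter hc.continuousAt
  have hmono : Monotone S := monotone_of_deriv_nonneg (fun t => (hder t).differentiableAt)
    fun t => by rw [(hder t).deriv]; exact h0 t
  have hS0 : S 0 = 0 := intervalIntegral.integral_same
  have hle : ∀ t ≤ 0, S t = 0 := by
    intro t ht
    simp only [hS]
    rw [intervalIntegral.integral_congr (g := fun _ => 0), intervalIntegral.integral_zero]
    intro s hs
    rw [uIcc_of_ge ht] at hs
    exact hneg s hs.2
  have hge : ∀ t, 1 ≤ t → S t = S 1 := by
    intro t ht
    have e := intervalIntegral.integral_add_adjacent_intervals (hi 0 1) (hi 1 t)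
    have e2 : ∫ s in (1 : ℝ)..t, S' s = 0 := by
      rw [intervalIntegral.integral_congr (g := fun _ => 0), intervalIntegral.integral_zero]
      intro s hs
      rw [uIcc_of_le ht] at hs
      exact hbig s hs.1
    rw [e2, add_zero] at e
    exact e.symm
  have hlt : ∀ t, 0 ≤ t → S t ≤ t := by
    intro t ht
    calc S t ≤ ∫ s in (0 : ℝ)..t, (1 : ℝ) :=
          intervalIntegral.integral_mono_on ht (hi 0 t) (by simp) fun s _ => h1 s
      _ = t := by simp
  have hpos : 0 < S 1 := by
    refine intervalIntegral.intervalIntegral_pos_of_pos_on (hi 0 1) (fun s hs => ?_) one_pos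
    exact lt_max_of_lt_right (lt_min hs.1 (by linarith [hs.2]))
  have hnn : ∀ t, 0 ≤ S t := by
    intro t
    rcases le_total t 0 with h | h
    · rw [hle t h]
    · rw [← hS0]; exact hmono h
  refine ⟨S 1, S, S', hpos, hlt 1 zero_le_one, hder, hc, h0, h1, hle, hge, hnn, fun t => ?_, hlt⟩
  rcases le_total t 1 with h | h
  · exact hmono h
  · rw [hge t h]

/-- Truncations of `t ↦ (t - k)⁺` at height comparable to `d`, of class `C^1`. -/
theorem exists_truncation : ∃ c : ℝ, 0 < c ∧ c ≤ 1 ∧ ∀ k d : ℝ, 0 < d → ∃ F F' : ℝ → ℝ,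
    (∀ t, HasDerivAt F (F' t) t) ∧ Continuous F' ∧ (∀ t, 0 ≤ F' t) ∧ (∀ t, F' t ≤ 1) ∧
    (∀ t ≤ k, F t = 0) ∧ (∀ t, k + d ≤ t → F t = c * d) ∧ (∀ t, 0 ≤ F t) ∧ (∀ t, F t ≤ c * d) ∧
    ∀ t, k ≤ t → F t ≤ t - k := by
  obtain ⟨c, S, S', hc, hc1, hder, hcont, h0, h1, hle, hge, hnn, hub, hlt⟩ := exists_smooth_step
  refine ⟨c, hc, hc1, fun k d hd => ⟨fun t => d * S ((t - k) / d), fun t => S' ((t - k) / d),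
    fun t => ?_, by fun_prop, fun t => h0 _, fun t => h1 _, fun t ht => ?_, fun t ht => ?_,
    fun t => mul_nonneg hd.le (hnn _), fun t => ?_, fun t ht => ?_⟩⟩
  · have e1 : HasDerivAt (fun t : ℝ => (t - k) / d) (1 / d) t :=
      ((hasDerivAt_id t).sub_const k).div_const d
    have e2 := ((hder ((t - k) / d)).comp t e1).const_mul d
    refine e2.congr_deriv ?_
    field_simp
  · change d * S _ = 0
    rw [hle _ (div_nonpos_of_nonpos_of_nonneg (by linarith) hd.le), mul_zero]
  · change d * S _ = _
    rw [hge _ (by rw [le_div_iff₀ hd]; linarith), mul_comm]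
  · change d * S _ ≤ _
    rw [mul_comm c]
    gcongr
    exact hub _
  · change d * S _ ≤ _
    calc d * S ((t - k) / d) ≤ d * ((t - k) / d) := by
          gcongr
          exact hlt _ (div_nonneg (by linarith) hd.le)
      _ = t - k := by field_simp

theorem IsSobolevWithGradient.comp {N : ℕ} {p : ℝ} {Ω : Set (RN N)} {u : RN N → ℝ}
    {G : RN N → RN N} (hp : 1 ≤ p) (hΩ : IsOpen Ω) (hΩf : volume Ω ≠ ⊤)
    (h : IsSobolevWithGradient p Ω u G) {F F' : ℝ → ℝ} (hF : ∀ t, HasDerivAt F (F' t) t)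
    (hF' : Continuous F') {C : ℝ} (hFC : ∀ t, |F t| ≤ C) (hFC' : ∀ t, |F' t| ≤ C) :
    IsSobolevWithGradient p Ω (fun x => F (u x)) (fun x => F' (u x) • G x) := by
  have hfin : IsFiniteMeasure (volume.restrict Ω) := ⟨by simpa using hΩf.lt_top⟩
  have hFc : Continuous F := continuous_iff_continuousAt.2 fun t => (hF t).continuousAt
  refine ⟨?_, ?_, h.isWeakGradient.comp hΩ hΩf (h.integrableOn hp hΩf)
    (h.integrableOn_grad hp hΩf) hF hF' hFC hFC'⟩
  · exact MemLp.of_bound (hFc.comp_aestronglyMeasurable h.memLp.aestronglyMeasurable) C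
      (Eventually.of_forall fun x => hFC _)
  · refine h.memLp_grad.of_le_mul (c := C)
      ((hF'.comp_aestronglyMeasurable h.memLp.aestronglyMeasurable).smul
        h.memLp_grad.aestronglyMeasurable) (Eventually.of_forall fun x => ?_)
    rw [norm_smul]
    gcongr
    exact hFC' _

theorem IsNeumannWeakSolution.congr {N : ℕ} {p τ : ℝ} {Ω : Set (RN N)} {f u v : RN N → ℝ}
    (hp : 1 ≤ p) (hΩ : volume Ω ≠ ⊤) (hu : IsNeumannWeakSolution p τ Ω f u)
    (huv : u =ᵐ[volume.restrict Ω] v) : IsNeumannWeakSolution p τ Ω f v := by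
  obtain ⟨G, hG, hu⟩ := hu
  refine ⟨G, hG.congr hp hΩ huv .rfl, fun ξ H hξ => ?_⟩
  rw [← hu ξ H hξ]
  congr 2
  exact integral_congr_ae (huv.mono fun x hx => by simp only [hx])

/-- The problem is odd, so upper bounds for solutions also give lower bounds. -/
theorem IsNeumannWeakSolution.neg {N : ℕ} {p τ : ℝ} {Ω : Set (RN N)} {f u : RN N → ℝ}
    (hp : 1 ≤ p) (hΩ : volume Ω ≠ ⊤) (hu : IsNeumannWeakSolution p τ Ω f u) :
    IsNeumannWeakSolution p τ Ω (fun x => -f x) (fun x => -u x) := by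
  obtain ⟨G, hG, hu⟩ := hu
  have h0 : IsSobolevWithGradient p Ω (fun x => -u x) (fun x => -G x) := by
    refine .of_integral_eq hp hΩ hG.memLp.neg hG.memLp_grad.neg fun φ h1 h2 h3 v => ?_
    simp only [neg_mul, inner_neg_left, mul_neg, integral_neg,
      hG.isWeakGradient.integral_eq φ h1 h2 h3 v]
  refine ⟨_, h0, fun ξ H hξ => ?_⟩
  simp only [norm_neg, abs_neg, inner_neg_left, mul_neg, neg_mul, integral_neg]
  rw [← hu ξ H hξ]
  ring

/-- Rests on `s ^ p ≤ s` for `s ∈ [0, 1]`. With `s = F' (u x)` and `g = G x` it bounds the gradient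
of the truncation by the diffusion term of the equation. -/
theorem norm_smul_rpow_le {E : Type*} [NormedAddCommGroup E] [InnerProductSpace ℝ E] {p s : ℝ}
    (hp : 1 < p) (hs0 : 0 ≤ s) (hs1 : s ≤ 1) (g : E) :
    ‖s • g‖ ^ p ≤ ‖g‖ ^ (p - 2) * inner ℝ g (s • g) := by
  have hp0 : 0 < p := by linarith
  have h1 : ‖g‖ ^ (p - 2) * ‖g‖ ^ 2 = ‖g‖ ^ p := by
    rcases (norm_nonneg g).eq_or_lt with h | h
    · rw [← h, Real.zero_rpow hp0.ne']; simp
    · rw [← Real.rpow_natCast, ← Real.rpow_add h]; norm_num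
  have h2 : s ^ p ≤ s := by
    rcases hs0.eq_or_lt with h | h
    · rw [← h, Real.zero_rpow hp0.ne']
    · calc s ^ p ≤ s ^ (1 : ℝ) := Real.rpow_le_rpow_of_exponent_ge h hs1 hp.le
        _ = s := Real.rpow_one s
  rw [norm_smul, Real.norm_of_nonneg hs0, Real.mul_rpow hs0 (norm_nonneg _), inner_smul_right,
    real_inner_self_eq_norm_sq, ← h1]
  have : 0 ≤ ‖g‖ ^ (p - 2) * ‖g‖ ^ 2 := by positivity
  nlinarith

/-- The counterpart for the zeroth-order term, with `t = u x` and `w = F (u x)`: for `k ≥ 0` the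
truncation either vanishes or is at most `u x - k ≤ u x`. -/
theorem rpow_le_abs_rpow_mul {p t w : ℝ} (hp : 1 < p) (hw : 0 ≤ w) (h : w = 0 ∨ w ≤ t) :
    ‖w‖ ^ p ≤ |t| ^ (p - 2) * t * w := by
  rw [Real.norm_of_nonneg hw]
  rcases hw.eq_or_lt with h0 | h0
  · rw [← h0, Real.zero_rpow (by linarith), mul_zero]
  · have hwt : w ≤ t := h.resolve_left h0.ne'
    have ht : 0 < t := h0.trans_le hwt
    rw [abs_of_pos ht, ← Real.rpow_add_one ht.ne']
    calc w ^ p = w ^ (p - 2 + 1) * w := by rw [← Real.rpow_add_one h0.ne']; ring_nf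
      _ ≤ t ^ (p - 2 + 1) * w := by
          gcongr
          linarith

theorem ofReal_integral_norm_rpow {α E : Type*} [MeasurableSpace α] {μ : Measure α}
    [NormedAddCommGroup E] {p : ℝ} (hp : 0 < p) {a : α → E} (ha : MemLp a (ENNReal.ofReal p) μ) :
    ENNReal.ofReal (∫ x, ‖a x‖ ^ p ∂μ) = ∫⁻ x, ‖a x‖ₑ ^ p ∂μ := by
  rw [ofReal_integral_eq_lintegral_ofReal (integrable_norm_rpow_ofReal hp ha)
    (Eventually.of_forall fun x => by positivity)]
  refine lintegral_congr fun x => ?_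
  rw [← ofReal_norm, ENNReal.ofReal_rpow_of_nonneg (norm_nonneg _) hp.le]

/-- The Caccioppoli type estimate obtained by testing the equation with a truncation of `u`. -/
theorem truncation_energy_le {N : ℕ} {p τ : ℝ} {Ω : Set (RN N)} (hp : 1 < p) (hτ : 0 < τ)
    {f u : RN N → ℝ} {G : RN N → RN N}
    (hu : ∀ (ξ : RN N → ℝ) (H : RN N → RN N), IsSobolevWithGradient p Ω ξ H →
      (∫ x in Ω, ‖G x‖ ^ (p - 2) * inner ℝ (G x) (H x))
        + τ * (∫ x in Ω, |u x| ^ (p - 2) * u x * ξ x) = ∫ x in Ω, f x * ξ x)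
    (hG : IsSobolevWithGradient p Ω u G) {F F' : ℝ → ℝ} {k d : ℝ} (hk : 0 ≤ k)
    (hF'0 : ∀ t, 0 ≤ F' t) (hF'1 : ∀ t, F' t ≤ 1) (hFk : ∀ t ≤ k, F t = 0) (hF0 : ∀ t, 0 ≤ F t)
    (hFd : ∀ t, F t ≤ d) (hFt : ∀ t, k ≤ t → F t ≤ t - k)
    (hw : IsSobolevWithGradient p Ω (fun x => F (u x)) (fun x => F' (u x) • G x)) :
    (∫⁻ x in Ω, ‖F (u x)‖ₑ ^ p) + ∫⁻ x in Ω, ‖F' (u x) • G x‖ₑ ^ p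
      ≤ ENNReal.ofReal (1 + 1 / τ) *
        (ENNReal.ofReal d * ∫⁻ x in Ω, {x | k < u x}.indicator (fun x => ‖f x‖ₑ) x) := by
  have hp0 : 0 < p := by linarith
  have key := hu _ _ hw
  have h1 : ∫ x in Ω, ‖F' (u x) • G x‖ ^ p
      ≤ ∫ x in Ω, ‖G x‖ ^ (p - 2) * inner ℝ (G x) (F' (u x) • G x) :=
    integral_mono (integrable_norm_rpow_ofReal hp0 hw.memLp_grad)
      (integrable_rpow_mul_inner hp hG.memLp_grad hw.memLp_grad)
      fun x => norm_smul_rpow_le hp (hF'0 _) (hF'1 _) (G x)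
  have hi2 : Integrable (fun x => |u x| ^ (p - 2) * u x * F (u x)) (volume.restrict Ω) := by
    refine (integrable_rpow_mul_inner hp hG.memLp hw.memLp).congr (Eventually.of_forall fun x => ?_)
    simp; ring
  have h2 : ∫ x in Ω, ‖F (u x)‖ ^ p ≤ ∫ x in Ω, |u x| ^ (p - 2) * u x * F (u x) := by
    refine integral_mono (integrable_norm_rpow_ofReal hp0 hw.memLp) hi2 fun x => ?_
    refine rpow_le_abs_rpow_mul hp (hF0 _) ?_
    rcases le_total (u x) k with h | h
    · exact Or.inl (hFk _ h)
    · exact Or.inr ((hFt _ h).trans (by linarith))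
  have n1 : 0 ≤ ∫ x in Ω, ‖F' (u x) • G x‖ ^ p := integral_nonneg fun x => by positivity
  have n2 : 0 ≤ ∫ x in Ω, ‖F (u x)‖ ^ p := integral_nonneg fun x => by positivity
  have h3 : (∫ x in Ω, ‖F (u x)‖ ^ p) + ∫ x in Ω, ‖F' (u x) • G x‖ ^ p
      ≤ (1 + 1 / τ) * ∫ x in Ω, f x * F (u x) := by
    have e : (∫ x in Ω, ‖F' (u x) • G x‖ ^ p) + τ * ∫ x in Ω, ‖F (u x)‖ ^ p
        ≤ ∫ x in Ω, f x * F (u x) := by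
      rw [← key]
      gcongr
    set a := ∫ x in Ω, ‖F' (u x) • G x‖ ^ p
    set b := ∫ x in Ω, ‖F (u x)‖ ^ p
    -- The factor `1 + 1 / τ` gives both `a` and `b` weight at least one, whatever the size of `τ`.
    calc b + a ≤ (1 + 1 / τ) * (a + τ * b) := by
          have : (1 + 1 / τ) * (a + τ * b) = b + a + (τ * b + 1 / τ * a) := by field_simp; ring
          rw [this]
          have : 0 ≤ τ * b + 1 / τ * a := by positivity
          linarith
      _ ≤ _ := by gcongr
  rw [← ofReal_integral_norm_rpow hp0 hw.memLp, ← ofReal_integral_norm_rpow hp0 hw.memLp_grad,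
    ← ENNReal.ofReal_add n2 n1]
  refine (ENNReal.ofReal_le_ofReal h3).trans ?_
  rw [ENNReal.ofReal_mul (by positivity)]
  gcongr
  calc ENNReal.ofReal (∫ x in Ω, f x * F (u x)) ≤ ‖∫ x in Ω, f x * F (u x)‖ₑ := by
        rw [← ofReal_norm]; exact ENNReal.ofReal_le_ofReal (Real.le_norm_self _)
    _ ≤ ∫⁻ x in Ω, ‖f x * F (u x)‖ₑ := enorm_integral_le_lintegral_enorm _
    _ ≤ ∫⁻ x in Ω, ENNReal.ofReal d * {x | k < u x}.indicator (fun x => ‖f x‖ₑ) x := by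
        refine lintegral_mono fun x => ?_
        by_cases hx : k < u x
        · rw [indicator_of_mem (by exact hx), enorm_mul, mul_comm]
          gcongr
          rw [← ofReal_norm, Real.norm_of_nonneg (hF0 _)]
          exact ENNReal.ofReal_le_ofReal (hFd _)
        · simp [hFk _ (not_lt.1 hx)]
    _ = _ := lintegral_const_mul' _ _ ENNReal.ofReal_ne_top

/-! ### Decay of superlevel sets and Stampacchia's lemma -/

/-- The decay of the measures of superlevel sets. -/
theorem exists_superlevel_decay {N : ℕ} {p τ θ : ℝ} {q : ℝ≥0∞} {Ω : Set (RN N)} (hp : 1 < p)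
    (hτ : 0 < τ) (hθ0 : 0 ≤ θ) (hθ1 : θ ≤ 1) (hθ : N * θ < p) (hq : 1 ≤ q) (hΩo : IsOpen Ω)
    (hΩb : Bornology.IsBounded Ω) (hΩl : HasLipschitzBoundary Ω) :
    ∃ K : ℝ, 0 ≤ K ∧ ∀ f u : RN N → ℝ, Measurable u → MemLp f q (volume.restrict Ω) →
      IsNeumannWeakSolution p τ Ω f u → ∀ k d : ℝ, 0 ≤ k → 0 < d →
        0 < volume.real (Ω ∩ {x | k + d < u x}) →
        d ^ (p - 1) * volume.real (Ω ∩ {x | k + d < u x}) ^ (1 - θ) ≤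
          K * (eLpNorm f q (volume.restrict Ω)).toReal *
            volume.real (Ω ∩ {x | k < u x}) ^ (1 - 1 / q.toReal) := by
  have hp0 : 0 < p := by linarith
  have hpq : p.HolderConjugate (p / (p - 1)) := Real.HolderConjugate.conjExponent hp
  set q' := p / (p - 1)
  have hq' := hpq.symm.pos
  have hΩf : volume Ω ≠ ⊤ := hΩb.measure_lt_top.ne
  obtain ⟨C, hC⟩ := exists_setLIntegral_enorm_le hpq hθ0 hθ1 hθ hΩo hΩb hΩl
  obtain ⟨c, hc, hc1, htr⟩ := exists_truncation
  set α := 1 / q' + θ / p with hα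
  have hα0 : 0 ≤ α := by positivity
  have hα1 : α ≤ 1 := by
    have h1 := hpq.inv_add_inv_eq_one
    have h2 : θ / p ≤ p⁻¹ := by rw [← one_div]; gcongr
    rw [hα, one_div]; linarith
  have hαp : p - α * p = 1 - θ := by
    have h1 := hpq.inv_add_inv_eq_one
    have h2 : q'⁻¹ = 1 - p⁻¹ := by linarith
    rw [hα, one_div, h2]; field_simp; ring
  -- Merges the two terms of the Sobolev-type inequality: `|B| ≤ |B| ^ α * |Ω| ^ (1 - α)`, and the
  -- `L^1` norm of the truncation is at most `E ^ (1 / p) * |Ω| ^ (1 / q')`.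
  set D : ℝ≥0∞ := C * (volume Ω ^ (1 - α) * volume Ω ^ (1 / q') + 1) with hDdef
  have hD : D ≠ ⊤ := by
    refine ENNReal.mul_ne_top ENNReal.coe_ne_top (ENNReal.add_ne_top.2 ⟨?_, ENNReal.one_ne_top⟩)
    exact ENNReal.mul_ne_top (ENNReal.rpow_ne_top_of_nonneg (by linarith) hΩf)
      (ENNReal.rpow_ne_top_of_nonneg (by positivity) hΩf)
  refine ⟨D.toReal ^ p * (1 + 1 / τ) / c ^ p, by positivity,
    fun f u hum hf ⟨G, hG, hu⟩ k d hk hd hpos => ?_⟩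
  obtain ⟨F, F', hF, hF'c, hF'0, hF'1, hFk, hFh, hF0, hFd, hFt⟩ := htr k d hd
  have hcd : c * d ≤ d := by nlinarith
  have hFc : Continuous F := continuous_iff_continuousAt.2 fun t => (hF t).continuousAt
  have hw : IsSobolevWithGradient p Ω (fun x => F (u x)) (fun x => F' (u x) • G x) := by
    refine hG.comp hp.le hΩo hΩf hF hF'c (C := max 1 d) (fun t => ?_) fun t => ?_
    · rw [abs_of_nonneg (hF0 t)]; exact ((hFd t).trans hcd).trans (le_max_right _ _)
    · rw [abs_of_nonneg (hF'0 t)]; exact (hF'1 t).trans (le_max_left _ _)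
  have hE := truncation_energy_le hp hτ hu hG hk hF'0 hF'1 hFk hF0 (fun t => (hFd t).trans hcd)
    hFt hw
  set E : ℝ≥0∞ := (∫⁻ x in Ω, ‖F (u x)‖ₑ ^ p) + ∫⁻ x in Ω, ‖F' (u x) • G x‖ₑ ^ p
  set A := Ω ∩ {x | k < u x}
  set B := Ω ∩ {x | k + d < u x}
  have hAm : MeasurableSet A := hΩo.measurableSet.inter (measurableSet_lt measurable_const hum)
  have hBm : MeasurableSet B := hΩo.measurableSet.inter (measurableSet_lt measurable_const hum)
  have hAf : volume A ≠ ⊤ := measure_ne_top_of_subset inter_subset_left hΩf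
  have hBf : volume B ≠ ⊤ := measure_ne_top_of_subset inter_subset_left hΩf
  have hqr : (1 : ℝ) / (1 : ℝ≥0∞).toReal - 1 / q.toReal = 1 - 1 / q.toReal := by simp
  have hfA : ∫⁻ x in Ω, {x | k < u x}.indicator (fun x => ‖f x‖ₑ) x
      ≤ eLpNorm f q (volume.restrict Ω) * volume A ^ (1 - 1 / q.toReal) := by
    rw [lintegral_indicator (measurableSet_lt measurable_const hum), Measure.restrict_restrict
      (measurableSet_lt measurable_const hum), inter_comm, ← eLpNorm_one_eq_lintegral_enorm]
    refine (eLpNorm_le_eLpNorm_mul_rpow_measure_univ hq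
      (hf.aestronglyMeasurable.mono_measure (Measure.restrict_mono_set _ inter_subset_left))).trans ?_
    rw [hqr, Measure.restrict_apply_univ]
    gcongr
    exact inter_subset_left
  have hw1 : ∫⁻ x in Ω, ‖F (u x)‖ₑ ≤ E ^ (1 / p) * volume Ω ^ (1 / q') := by
    have h1 := ENNReal.lintegral_mul_le_Lp_mul_Lq (volume.restrict Ω) hpq
      (f := fun x => ‖F (u x)‖ₑ) (g := fun _ => 1) (hFc.measurable.comp hum).enorm.aemeasurable
      aemeasurable_const
    simp only [Pi.mul_def, mul_one, ENNReal.one_rpow, lintegral_const, one_mul,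
      Measure.restrict_apply_univ] at h1
    refine h1.trans ?_
    gcongr
    exact le_self_add
  have hsob := hC hw.isWeakGradient (hw.integrableOn hp.le hΩf) (hw.integrableOn_grad hp.le hΩf)
    B inter_subset_left hBm
  -- On `B` the truncation has reached its full height `c * d`.
  have hlow : ENNReal.ofReal (c * d) * volume B ≤ ∫⁻ x in B, ‖F (u x)‖ₑ := by
    rw [← setLIntegral_const]
    refine setLIntegral_mono' hBm fun x hx => ?_
    rw [hFh _ (le_of_lt hx.2), ← ofReal_norm]
    exact ENNReal.ofReal_le_ofReal (Real.le_norm_self _)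
  have hBα : volume B ≤ volume B ^ α * volume Ω ^ (1 - α) := by
    calc volume B = volume B ^ α * volume B ^ (1 - α) := by
          rw [← ENNReal.rpow_add_of_nonneg _ _ hα0 (by linarith)]; simp
      _ ≤ _ := by gcongr; exact inter_subset_left
  have hup : ∫⁻ x in B, ‖F (u x)‖ₑ ≤ D * volume B ^ α * E ^ (1 / p) := by
    refine hsob.trans ?_
    calc _ ≤ C * (volume B ^ α * volume Ω ^ (1 - α) * (E ^ (1 / p) * volume Ω ^ (1 / q')) +
          volume B ^ α * E ^ (1 / p)) := by
          gcongr
          exact le_add_self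
      _ = _ := by rw [hDdef]; ring
  have hE2 : E ≤ ENNReal.ofReal (1 + 1 / τ) * (ENNReal.ofReal d *
      (eLpNorm f q (volume.restrict Ω) * volume A ^ (1 - 1 / q.toReal))) := hE.trans (by gcongr)
  have hσ : 0 ≤ 1 - 1 / q.toReal := by
    rcases eq_or_ne q ⊤ with h | h
    · simp [h]
    · have : 1 ≤ q.toReal := by simpa using ENNReal.toReal_mono h hq
      rw [sub_nonneg, div_le_one (by linarith)]
      exact this
  have hfin : D * volume B ^ α * (ENNReal.ofReal (1 + 1 / τ) * (ENNReal.ofReal d *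
      (eLpNorm f q (volume.restrict Ω) * volume A ^ (1 - 1 / q.toReal)))) ^ (1 / p) ≠ ⊤ := by
    refine ENNReal.mul_ne_top (ENNReal.mul_ne_top hD (ENNReal.rpow_ne_top_of_nonneg hα0 hBf))
      (ENNReal.rpow_ne_top_of_nonneg (by positivity) ?_)
    refine ENNReal.mul_ne_top ENNReal.ofReal_ne_top (ENNReal.mul_ne_top ENNReal.ofReal_ne_top ?_)
    exact ENNReal.mul_ne_top hf.eLpNorm_ne_top (ENNReal.rpow_ne_top_of_nonneg hσ hAf)
  have hmain := ENNReal.toReal_mono hfin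
    (hlow.trans (hup.trans (mul_le_mul' le_rfl (ENNReal.rpow_le_rpow hE2 (by positivity)))))
  simp only [ENNReal.toReal_mul, ← ENNReal.toReal_rpow] at hmain
  rw [ENNReal.toReal_ofReal (by positivity), ENNReal.toReal_ofReal (by positivity),
    ENNReal.toReal_ofReal hd.le] at hmain
  change c * d * volume.real B ≤ D.toReal * volume.real B ^ α *
    ((1 + 1 / τ) * (d * ((eLpNorm f q (volume.restrict Ω)).toReal *
      volume.real A ^ (1 - 1 / q.toReal)))) ^ (1 / p) at hmain
  set b := volume.real B
  set a := volume.real A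
  have ha : 0 ≤ a := measureReal_nonneg
  set Q := (eLpNorm f q (volume.restrict Ω)).toReal
  have hQ : 0 ≤ Q := ENNReal.toReal_nonneg
  have hpow := Real.rpow_le_rpow (by positivity) hmain hp0.le
  have hin : 0 ≤ (1 + 1 / τ) * (d * (Q * a ^ (1 - 1 / q.toReal))) := by positivity
  rw [Real.mul_rpow (by positivity) hpos.le, Real.mul_rpow hc.le hd.le,
    Real.mul_rpow (by positivity) (by positivity), Real.mul_rpow (by positivity) (by positivity),
    ← Real.rpow_mul hin, one_div_mul_cancel hp0.ne', Real.rpow_one,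
    ← Real.rpow_mul hpos.le] at hpow
  -- After taking `p`-th powers both sides share the factor `d * b ^ (α * p)`, cancelled below. This
  -- needs `b > 0`; for `b = 0` and `θ = 1` the left side of the claim would contain `0 ^ 0 = 1`.
  have e1 : b ^ p = b ^ (1 - θ) * b ^ (α * p) := by
    rw [← Real.rpow_add hpos, ← hαp]; ring_nf
  have e2 : d ^ p = d ^ (p - 1) * d := by
    rw [← Real.rpow_add_one hd.ne']; ring_nf
  rw [e1, e2] at hpow
  have hX : 0 < d * b ^ (α * p) := by positivity
  rw [div_mul_eq_mul_div, div_mul_eq_mul_div, le_div_iff₀ (by positivity)]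
  refine le_of_mul_le_mul_right ?_ hX
  linarith

/-- Stampacchia's lemma. -/
theorem exists_eq_zero_of_superlevel_decay {P s σ K m : ℝ} (hP : 0 < P) (hs : 0 < s) (hsσ : s < σ)
    (hK : 0 ≤ K) (hm : 0 < m) :
    ∃ K' : ℝ, 0 ≤ K' ∧ ∀ (a : ℝ → ℝ) (Q : ℝ), Antitone a → (∀ k, 0 ≤ a k) → (∀ k, a k ≤ m) →
      0 ≤ Q → (∀ k d, 0 ≤ k → 0 < d → 0 < a (k + d) → d ^ P * a (k + d) ^ s ≤ K * Q * a k ^ σ) →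
      ∀ d, 0 < d → K' * Q ≤ d ^ P → a d = 0 := by
  -- Chosen so that `μ ^ (σ - s) = 2 ^ (-P)`: the gain from `σ > s` at each step then exactly
  -- offsets the factor `2 ^ P` lost by halving the increment.
  set μ : ℝ := 2 ^ (-(P / (σ - s))) with hμ
  have hσs : 0 < σ - s := by linarith
  have hμ0 : 0 < μ := by positivity
  have hμ1 : μ < 1 := Real.rpow_lt_one_of_one_lt_of_neg one_lt_two (by
    have : 0 < P / (σ - s) := by positivity
    linarith)
  have hμP : μ ^ σ * 2 ^ P = μ ^ s := by
    have h1 : (2 : ℝ) ^ P = μ ^ (s - σ) := by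
      rw [hμ, ← Real.rpow_mul (by norm_num)]
      congr 1
      rw [← neg_sub σ s]
      field_simp
    rw [h1, ← Real.rpow_add hμ0]
    ring_nf
  -- This `K'` is what the first induction step requires; by the choice of `μ` all later steps need
  -- the same inequality.
  refine ⟨K * 2 ^ P * m ^ (σ - s) / μ ^ s, by positivity, fun a Q ha ha0 ham hQ h d hd hKd => ?_⟩
  by_contra hne
  have hpos : 0 < a d := lt_of_le_of_ne (ha0 d) (Ne.symm hne)
  have hKQ : K * Q * 2 ^ P * m ^ σ ≤ d ^ P * (m * μ) ^ s := by
    rw [div_mul_eq_mul_div, div_le_iff₀ (by positivity)] at hKd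
    have e : m ^ σ = m ^ (σ - s) * m ^ s := by rw [← Real.rpow_add hm]; ring_nf
    rw [e, Real.mul_rpow hm.le hμ0.le]
    have := mul_le_mul_of_nonneg_right hKd (by positivity : 0 ≤ m ^ s)
    linarith
  -- The levels increase to `d`, so by monotonicity `a d` lies below a null sequence. The assumption
  -- `0 < a d` keeps every level positive, as the decay hypothesis demands.
  have hlev : ∀ j : ℕ, a (d * (1 - (1 / 2) ^ j)) ≤ m * μ ^ j := by
    intro j
    induction j with
    | zero => simpa using ham 0
    | succ j ih =>
      have hj1 : ((1 : ℝ) / 2) ^ j ≤ 1 := pow_le_one₀ (by norm_num) (by norm_num)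
      have hj0 : 0 < ((1 : ℝ) / 2) ^ j := by positivity
      have e1 : d * (1 - (1 / 2) ^ (j + 1)) = d * (1 - (1 / 2) ^ j) + d * (1 / 2) ^ (j + 1) := by
        rw [pow_succ]; ring
      have hp1 : 0 < a (d * (1 - (1 / 2) ^ (j + 1))) :=
        hpos.trans_le (ha (by
          have : 0 < d * ((1 : ℝ) / 2) ^ (j + 1) := by positivity
          linarith))
      have h1 := h (d * (1 - (1 / 2) ^ j)) (d * (1 / 2) ^ (j + 1))
        (mul_nonneg hd.le (by linarith)) (by positivity) (by rwa [← e1])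
      rw [← e1] at h1
      set b := a (d * (1 - (1 / 2) ^ (j + 1)))
      have h2 : K * Q * a (d * (1 - (1 / 2) ^ j)) ^ σ ≤ K * Q * (m ^ σ * (μ ^ σ) ^ j) := by
        have : (m * μ ^ j) ^ σ = m ^ σ * (μ ^ σ) ^ j := by
          rw [Real.mul_rpow hm.le (by positivity), ← Real.rpow_natCast, ← Real.rpow_mul hμ0.le,
            mul_comm (j : ℝ), Real.rpow_mul hμ0.le, Real.rpow_natCast]
        rw [← this]
        have h3 : 0 ≤ σ := by linarith
        gcongr
        exact ha0 _
      have e2 : (d * (1 / 2) ^ (j + 1)) ^ P = d ^ P / (2 ^ P * (2 ^ P) ^ j) := by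
        rw [Real.mul_rpow hd.le (by positivity), ← Real.rpow_natCast, ← Real.rpow_mul (by norm_num),
          mul_comm ((j + 1 : ℕ) : ℝ), Real.rpow_mul (by norm_num), Real.rpow_natCast,
          Real.div_rpow (by norm_num) (by norm_num), Real.one_rpow, div_pow, one_pow, pow_succ']
        ring
      have h3 := h1.trans h2
      rw [e2, div_mul_eq_mul_div, div_le_iff₀ (by positivity)] at h3
      have h4 : d ^ P * b ^ s ≤ d ^ P * (m * μ ^ (j + 1)) ^ s := by
        calc d ^ P * b ^ s ≤ K * Q * (m ^ σ * (μ ^ σ) ^ j) * (2 ^ P * (2 ^ P) ^ j) := h3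
          _ = K * Q * 2 ^ P * m ^ σ * (μ ^ σ * 2 ^ P) ^ j := by rw [mul_pow]; ring
          _ ≤ d ^ P * (m * μ) ^ s * (μ ^ σ * 2 ^ P) ^ j := by gcongr
          _ = d ^ P * (m * μ ^ (j + 1)) ^ s := by
            rw [hμP, ← Real.rpow_natCast, ← Real.rpow_mul hμ0.le, mul_comm s,
              Real.rpow_mul hμ0.le, Real.rpow_natCast, mul_assoc,
              ← Real.mul_rpow (by positivity) (by positivity), pow_succ']
            ring_nf
      exact (Real.rpow_le_rpow_iff hp1.le (by positivity) hs).1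
        (le_of_mul_le_mul_left h4 (by positivity))
  have hlim : Tendsto (fun j : ℕ => m * μ ^ j) atTop (𝓝 (m * 0)) :=
    (tendsto_pow_atTop_nhds_zero_of_lt_one hμ0.le hμ1).const_mul m
  rw [mul_zero] at hlim
  refine hpos.not_ge (ge_of_tendsto' hlim fun j => (ha ?_).trans (hlev j))
  have : 0 < d * ((1 : ℝ) / 2) ^ j := by positivity
  linarith

/-! ### The supremum bound -/

theorem exists_superlevel_null {N : ℕ} {p τ : ℝ} {q : ℝ≥0∞} {Ω : Set (RN N)} (hp : 1 < p)
    (hτ : 0 < τ) (hq : 1 ≤ q) (hNq : ENNReal.ofReal (N / p) < q) (hΩo : IsOpen Ω)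
    (hΩb : Bornology.IsBounded Ω) (hΩl : HasLipschitzBoundary Ω) :
    ∃ K : ℝ, 0 ≤ K ∧ ∀ f u : RN N → ℝ, Measurable u → MemLp f q (volume.restrict Ω) →
      IsNeumannWeakSolution p τ Ω f u → ∀ d, 0 < d →
        K * (eLpNorm f q (volume.restrict Ω)).toReal ≤ d ^ (p - 1) →
        volume.real (Ω ∩ {x | d < u x}) = 0 := by
  have hp0 : 0 < p := by linarith
  have hΩf : volume Ω ≠ ⊤ := hΩb.measure_lt_top.ne
  have hr0 : 0 ≤ 1 / q.toReal := by positivity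
  -- Here `N < p`, so `θ = 1` is allowed and both exponents in the decay relation are zero: a
  -- superlevel set of positive measure at height `d` forces `d ^ (p - 1) ≤ K * Q`, with `Q =
  -- ‖f‖_1`, without iteration. The constant `K + 1` makes the contradiction strict.
  by_cases hq1 : q = 1
  · have hNp : (N : ℝ) * 1 < p := by
      rw [hq1, ENNReal.ofReal_lt_one, div_lt_one hp0] at hNq
      linarith
    obtain ⟨K, hK, h⟩ := exists_superlevel_decay hp hτ zero_le_one le_rfl hNp hq hΩo hΩb hΩl
    refine ⟨K + 1, by positivity, fun f u hum hf hu d hd hKd => ?_⟩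
    by_contra hne
    have hpos : 0 < volume.real (Ω ∩ {x | d < u x}) :=
      lt_of_le_of_ne measureReal_nonneg (Ne.symm hne)
    have := h f u hum hf hu 0 d le_rfl hd (by rwa [zero_add])
    simp only [hq1, sub_self, Real.rpow_zero, mul_one, ENNReal.toReal_one, div_one] at this
    rw [hq1] at hKd
    have hd' : 0 < d ^ (p - 1) := by positivity
    have hQ : 0 ≤ (eLpNorm f 1 (volume.restrict Ω)).toReal := ENNReal.toReal_nonneg
    nlinarith
  · have hq1' : 1 < q := lt_of_le_of_ne hq (Ne.symm hq1)
    have hr1 : 1 / q.toReal < 1 := by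
      rcases eq_or_ne q ⊤ with h | h
      · simp [h]
      · have : 1 < q.toReal := by simpa using (ENNReal.toReal_lt_toReal (by simp) h).2 hq1'
        rw [div_lt_one (by linarith)]; exact this
    -- Stampacchia's lemma needs `1 - θ < 1 - 1 / q`, the Sobolev-type inequality `N θ < p`; both
    -- can be met because `1 / q < min 1 (p / N)`. For `q = ⊤` the convention `1 / 0 = 0` gives the
    -- right value of `1 / q`.
    obtain ⟨θ, hθ1, hθr, hθN⟩ : ∃ θ : ℝ, θ < 1 ∧ 1 / q.toReal < θ ∧ N * θ < p := by
      rcases Nat.eq_zero_or_pos N with hN | hN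
      · obtain ⟨θ, h1, h2⟩ := exists_between hr1
        exact ⟨θ, h2, h1, by simpa [hN] using hp0⟩
      · have hN' : (0 : ℝ) < N := by exact_mod_cast hN
        have hrN : 1 / q.toReal < p / N := by
          rcases eq_or_ne q ⊤ with h | h
          · simp only [h, ENNReal.toReal_top, div_zero]; positivity
          · have h1 : (N : ℝ) / p < q.toReal := (ENNReal.ofReal_lt_iff_lt_toReal (by positivity) h).1 hNq
            have h2 : (0 : ℝ) < N / p := by positivity
            have h3 := one_div_lt_one_div_of_lt h2 h1
            rwa [one_div_div] at h3
        obtain ⟨θ, h1, h2⟩ := exists_between (lt_min hr1 hrN)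
        rw [lt_min_iff, lt_div_iff₀ hN'] at h2
        exact ⟨θ, h2.1, h1, by linarith [h2.2]⟩
    obtain ⟨K, hK, h⟩ := exists_superlevel_decay hp hτ (by linarith) hθ1.le hθN hq hΩo hΩb hΩl
    -- Adding `1` to the volume makes `m` positive without a case distinction.
    obtain ⟨K', hK', h'⟩ := exists_eq_zero_of_superlevel_decay (P := p - 1) (s := 1 - θ)
      (σ := 1 - 1 / q.toReal) (m := volume.real Ω + 1) (by linarith) (by linarith) (by linarith) hK
      (by positivity)
    refine ⟨K', hK', fun f u hum hf hu => ?_⟩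
    refine h' (fun k => volume.real (Ω ∩ {x | k < u x})) _ ?_ (fun k => measureReal_nonneg) ?_
      ENNReal.toReal_nonneg (h f u hum hf hu)
    · intro k k' hk
      refine measureReal_mono (inter_subset_inter_right _ fun x hx => lt_of_le_of_lt hk hx)
        (measure_ne_top_of_subset inter_subset_left hΩf)
    · intro k
      have := measureReal_mono (μ := volume) (inter_subset_left : Ω ∩ {x | k < u x} ⊆ Ω) hΩf
      linarith

theorem IsNeumannWeakSolution.exists_eLpNorm_top_le {N : ℕ} {p τ : ℝ} {q : ℝ≥0∞} {Ω : Set (RN N)}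
    (hp : 1 < p) (hτ : 0 < τ) (hq : 1 ≤ q) (hNq : ENNReal.ofReal (N / p) < q) (hΩo : IsOpen Ω)
    (hΩb : Bornology.IsBounded Ω) (hΩl : HasLipschitzBoundary Ω) :
    ∃ c : ℝ, 0 < c ∧ ∀ f u : RN N → ℝ, MemLp f q (volume.restrict Ω) →
      IsNeumannWeakSolution p τ Ω f u → eLpNorm u ⊤ (volume.restrict Ω) ≤
        ENNReal.ofReal (c * (eLpNorm f q (volume.restrict Ω)).toReal ^ (1 / (p - 1))) := by
  have hp1 : 0 < p - 1 := by linarith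
  have hΩf : volume Ω ≠ ⊤ := hΩb.measure_lt_top.ne
  obtain ⟨K, hK, h⟩ := exists_superlevel_null hp hτ hq hNq hΩo hΩb hΩl
  refine ⟨K ^ (1 / (p - 1)) + 1, by positivity, fun f u hf hu => ?_⟩
  have hum : AEMeasurable u (volume.restrict Ω) := by
    obtain ⟨G, hG, _⟩ := hu
    exact hG.memLp.aestronglyMeasurable.aemeasurable
  have hu' := hu.congr hp.le hΩf hum.ae_eq_mk
  set v := hum.mk u
  have hvm : Measurable v := hum.measurable_mk
  rw [eLpNorm_congr_ae hum.ae_eq_mk]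
  set Q := (eLpNorm f q (volume.restrict Ω)).toReal
  have hQ : 0 ≤ Q := ENNReal.toReal_nonneg
  refine ENNReal.le_of_forall_pos_le_add fun ε hε _ => ?_
  -- The summand `ε` keeps the level positive when `Q = 0`; the `+ 1` serves only to make the final
  -- constant positive.
  set d : ℝ := (K ^ (1 / (p - 1)) + 1) * Q ^ (1 / (p - 1)) + ε
  have hεR : (0 : ℝ) < ε := hε
  have hd : 0 < d := by positivity
  have hdK : K * Q ≤ d ^ (p - 1) := by
    have h1 : (K * Q) ^ (1 / (p - 1)) ≤ d := by
      rw [Real.mul_rpow hK hQ]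
      have : 0 ≤ Q ^ (1 / (p - 1)) := by positivity
      simp only [d]
      linarith
    have h2 := Real.rpow_le_rpow (by positivity) h1 hp1.le
    rwa [← Real.rpow_mul (by positivity), one_div_mul_cancel hp1.ne', Real.rpow_one] at h2
  have hae : ∀ w : RN N → ℝ, Measurable w → volume.real (Ω ∩ {x | d < w x}) = 0 →
      ∀ᵐ x ∂volume.restrict Ω, w x ≤ d := by
    intro w hw h0
    have hset : {x | ¬w x ≤ d} = {x | d < w x} := by ext x; simp
    rw [ae_iff, hset, Measure.restrict_apply (measurableSet_lt measurable_const hw), inter_comm]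
    exact (measureReal_eq_zero_iff (measure_ne_top_of_subset inter_subset_left hΩf)).1 h0
  have h1 := hae v hvm (h f v hvm hf hu' d hd hdK)
  have h2 := hae (fun x => -v x) hvm.neg (h (fun x => -f x) _ hvm.neg hf.neg (hu'.neg hp.le hΩf) d hd
    (by
      have : eLpNorm (fun x => -f x) q (volume.restrict Ω) = eLpNorm f q (volume.restrict Ω) :=
        eLpNorm_neg f q _
      rw [this]; exact hdK))
  rw [eLpNorm_exponent_top]
  refine (eLpNormEssSup_le_of_ae_bound (C := d) ?_).trans (le_of_eq ?_)
  · filter_upwards [h1, h2] with x hx1 hx2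
    rw [Real.norm_eq_abs, abs_le]
    exact ⟨by linarith, hx1⟩
  · simp only [d]
    rw [ENNReal.ofReal_add (by positivity) hεR.le, ENNReal.ofReal_coe_nnreal]

theorem mainTheorem3 (N : ℕ) (hN : 1 ≤ N) (Ω : Set (RN N)) (hΩ_open : IsOpen Ω)
    (hΩ_conn : IsConnected Ω) (hΩ_bdd : Bornology.IsBounded Ω) (hΩ_lip : HasLipschitzBoundary Ω)
    (p : ℝ) (hp : 1 < p) (τ : ℝ) (hτ : 0 < τ) :
    (∀ f : RN N → ℝ, MemLp f (ENNReal.ofReal (p / (p - 1))) (volume.restrict Ω) →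
      (∃ u : RN N → ℝ, IsNeumannWeakSolution p τ Ω f u) ∧
      ∀ u v : RN N → ℝ, IsNeumannWeakSolution p τ Ω f u → IsNeumannWeakSolution p τ Ω f v →
        u =ᵐ[volume.restrict Ω] v) ∧
    ∀ q : ℝ≥0∞, 1 ≤ q → ENNReal.ofReal ((N : ℝ) / p) < q →
      ∃ c : ℝ, 0 < c ∧
        ∀ f : RN N → ℝ, MemLp f (ENNReal.ofReal (p / (p - 1))) (volume.restrict Ω) →
          MemLp f q (volume.restrict Ω) →
          ∀ u : RN N → ℝ, IsNeumannWeakSolution p τ Ω f u →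
            MemLp u ∞ (volume.restrict Ω) ∧
            (eLpNorm u ∞ (volume.restrict Ω)).toReal ≤
              c * (eLpNorm u 1 (volume.restrict Ω)).toReal
                + c * (eLpNorm f q (volume.restrict Ω)).toReal ^ (1 / (p - 1)) := by
  have hΩf : volume Ω ≠ ⊤ := hΩ_bdd.measure_lt_top.ne
  refine ⟨fun f hf => ⟨exists_isNeumannWeakSolution hp hτ hΩf hf,
    fun u v hu hv => hu.ae_eq hp hτ hΩf hv⟩, fun q hq hNq => ?_⟩
  obtain ⟨c, hc, h⟩ := IsNeumannWeakSolution.exists_eLpNorm_top_le hp hτ hq hNq hΩ_open hΩ_bdd hΩ_lip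
  refine ⟨c, hc, fun f _ hf u hu => ?_⟩
  have hle := h f u hf hu
  have hlt := hle.trans_lt ENNReal.ofReal_lt_top
  have hmeas : AEStronglyMeasurable u (volume.restrict Ω) := by
    obtain ⟨G, hG, _⟩ := hu
    exact hG.memLp.aestronglyMeasurable
  refine ⟨⟨hmeas, hlt⟩, (ENNReal.toReal_le_of_le_ofReal (by positivity) hle).trans ?_⟩
  -- The bound by `f` alone already holds, so the `L^1` term is added for free.
  exact le_add_of_nonneg_left (by positivity)
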